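/- Let $n,m\ge 0$ be integers, let $E=\mathbb C^n$ and $F=\mathbb C^m$ with orthonormal bases $(e_i)$, $(f_j)$, and let $u=(u_{(i,j),(k,l)})$ be a unitary matrix indexed by $\{1,\dots,n\}\times\{1,\dots,m\}$. Let $\mathcal F$ be the Hilbert space direct sum $\bigoplus_{k,l\ge 0}E^{\otimes k}\otimes F^{\otimes l}$, where $E\otimes F$ and $F\otimes E$ are identified by $e_i\otimes f_j=\sum_{k,l}u_{(i,j),(k,l)}\,f_l\otimes e_k$, equivalently $f_l\otimes e_k=\sum_{i,j}\overline{u_{(i,j),(k,l)}}\,e_i\otimes f_j$. Let $L_{e_i}$, $L_{f_j}$ be the operators on $\mathcal F$ of left tensoring by $e_i$ and $f_j$. Let $\mathcal A_u$ and $\mathcal L_u$ be, respectively, the norm closure and the weak-* closure in $B(\mathcal F)$ of the unital algebra generated by all the $L_{e_i}$, $L_{f_j}$. A character $\varphi$ (a unital multiplicative linear functional) of $\mathcal A_u$, or a weak-* continuous character of $\mathcal L_u$, is determined by the point $\big((\varphi(L_{e_i}))_i,(\varphi(L_{f_j}))_j\big)\in\mathbb C^n\times\mathbb C^m$. For an algebra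 automorphism $\Psi$ of $\mathcal A_u$, write $\theta_\Psi(p)=q$ if the character $\varphi$ of $\mathcal A_u$ with point $p$ is such that $\varphi\circ\Psi^{-1}$ has point $q$. For an automorphism $\Psi$ of $\mathcal L_u$ that is a homeomorphism in the weak-* topology, $\theta_\Psi$ is defined in the same way with the weak-* continuous characters of $\mathcal L_u$. Let $\mathbb B_n$ be the open Euclidean unit ball of $\mathbb C^n$. Let $C_{(i,j)}$ be the $n\times m$ matrix with $(k,l)$ entry $u_{(i,j),(k,l)}-\delta_{ik}\delta_{jl}$, and let the core be $$\Omega_u^0=\{(z,w)\in\overline{\mathbb B}_n\times\overline{\mathbb B}_m : C_{(i,j)}w=0,\ C_{(i,j)}^{t}z=0\ \text{ for all } i,j\}.$$ Then, for $(z,w)\in\mathbb B_n\times\mathbb B_m$, the following conditions are equivalent: 1. $(z,w)\in\Omega_u^0$; 2. there is a completely isometric automorphism $\Psi$ of $\mathcal L_u$ that is a homeomorphism in the weak-* topology and restricts to an automorphism of $\mathcal A_u$, such that $\theta_\Psi(0,0)=(z,w)$; 3. there is an algebraic automorphism $\Psi$ of $\mathcal A_u$ such that $\theta_\Psi(0,0)=(z,w)$.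 Moreover, the relative interior of the convex set $\Omega_u^0$ (its interior in its real affine span) equals $\Omega_u^0\cap(\mathbb B_n\times\mathbb B_m)$, and this set is the orbit $\{\theta_\Psi(0,0) : \Psi \text{ an algebraic automorphism of } \mathcal A_u\}$. -/

import Mathlib

open scoped lp ComplexConjugate

noncomputable section

namespace UnitaryRelation

/-! ### The weak-* topology on the bounded operators of a Hilbert space -/

section WeakStar

variable (H : Type*) [NormedAddCommGroup H] [InnerProductSpace ℂ H]

/-- The weak-* (σ-weak, ultraweak) topology on `B(H)`: the coarsest topology for which all the
functionals `T ↦ ∑ₖ ⟨T xₖ, yₖ⟩`, with `∑ ‖xₖ‖² < ∞` and `∑ ‖yₖ‖² < ∞`, are continuous. -/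
@[reducible]
def weakStar : TopologicalSpace (H →L[ℂ] H) :=
  TopologicalSpace.induced
    (fun T (p : ℓ²(ℕ, H) × ℓ²(ℕ, H)) => ∑' k, inner ℂ (p.2 k) (T (p.1 k))) inferInstance

variable {H}

/-- The entrywise action of an operator on a square summable sequence. -/
def seqMap (T : H →L[ℂ] H) : ℓ²(ℕ, H) →L[ℂ] ℓ²(ℕ, H) :=
  lp.mapCLM 2 (fun _ => T) (norm_nonneg T) (fun _ => le_rfl)

theorem seqMap_apply (T : H →L[ℂ] H) (x : ℓ²(ℕ, H)) (k : ℕ) : seqMap T x k = T (x k) := rfl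

theorem continuous_weakStar_eval (x y : ℓ²(ℕ, H)) :
    @Continuous _ _ (weakStar H) _ (fun T : H →L[ℂ] H => ∑' k, inner ℂ (y k) (T (x k))) := by
  let _ := weakStar H
  have h : Continuous fun (T : H →L[ℂ] H) (p : ℓ²(ℕ, H) × ℓ²(ℕ, H)) =>
      ∑' k, inner ℂ (p.2 k) (T (p.1 k)) := continuous_induced_dom
  exact (continuous_pi_iff.1 h) (x, y)

/-- In the weak-* topology addition is continuous and multiplication is separately continuous. -/
theorem isSemitopologicalSemiring_weakStar [CompleteSpace H] :
    @IsSemitopologicalSemiring (H →L[ℂ] H) (weakStar H) _ := by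
  let _ := weakStar H
  refine @IsSemitopologicalSemiring.mk _ _ _ ⟨?_⟩ ⟨?_, ?_⟩
  · refine continuous_induced_rng.2 (continuous_pi fun p => ?_)
    have h : ∀ T : H →L[ℂ] H, Summable fun k => inner ℂ (p.2 k) (T (p.1 k)) :=
      fun T => lp.summable_inner p.2 (seqMap T p.1)
    have e : (fun q : (H →L[ℂ] H) × (H →L[ℂ] H) =>
        ∑' k, inner ℂ (p.2 k) ((q.1 + q.2) (p.1 k))) = fun q =>
        (∑' k, inner ℂ (p.2 k) (q.1 (p.1 k))) + ∑' k, inner ℂ (p.2 k) (q.2 (p.1 k)) := by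
      funext q
      rw [← (h q.1).tsum_add (h q.2)]
      exact tsum_congr fun k => by rw [add_apply, inner_add_right]
    have c := continuous_weakStar_eval p.1 p.2
    exact e ▸ (c.comp continuous_fst).add (c.comp continuous_snd)
  · intro S
    refine continuous_induced_rng.2 (continuous_pi fun p => ?_)
    have e : (fun T : H →L[ℂ] H => ∑' k, inner ℂ (p.2 k) ((S * T) (p.1 k))) = fun T =>
        ∑' k, inner ℂ (seqMap (ContinuousLinearMap.adjoint S) p.2 k) (T (p.1 k)) := by
      funext T
      exact tsum_congr fun k => by
        rw [seqMap_apply, ContinuousLinearMap.adjoint_inner_left]; rfl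
    exact e ▸ continuous_weakStar_eval p.1 _
  · intro S
    refine continuous_induced_rng.2 (continuous_pi fun p => ?_)
    exact continuous_weakStar_eval (seqMap S p.1) p.2

/-- The weak-* closure of a subalgebra of `B(H)`. -/
def weakStarClosure [CompleteSpace H] (A : Subalgebra ℂ (H →L[ℂ] H)) :
    Subalgebra ℂ (H →L[ℂ] H) :=
  @Subalgebra.topologicalClosure ℂ _ (H →L[ℂ] H) _ (weakStar H) _
    isSemitopologicalSemiring_weakStar A

/-- The weak-* topology of an operator algebra `A ⊆ B(H)`. -/
@[reducible]
def weakStarOn (A : Subalgebra ℂ (H →L[ℂ] H)) : TopologicalSpace A :=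
  TopologicalSpace.induced Subtype.val (weakStar H)

/-- The operator on `H ⊕ ⋯ ⊕ H` (`k` summands, Hilbert space direct sum) given by a `k × k`
matrix of operators on `H`. -/
def matrixOp {k : ℕ} (M : Matrix (Fin k) (Fin k) (H →L[ℂ] H)) :
    PiLp 2 (fun _ : Fin k => H) →L[ℂ] PiLp 2 (fun _ : Fin k => H) :=
  (PiLp.continuousLinearEquiv 2 ℂ (fun _ : Fin k => H)).symm.toContinuousLinearMap ∘L
    (ContinuousLinearMap.pi fun i => ∑ j, M i j ∘L PiLp.proj 2 (fun _ : Fin k => H) j)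

/-- A map between operator algebras is completely isometric if all its amplifications to matrix
algebras are isometric. -/
def CompletelyIsometric {A B : Subalgebra ℂ (H →L[ℂ] H)} (Ψ : A → B) : Prop :=
  ∀ (k : ℕ) (M : Matrix (Fin k) (Fin k) A),
    ‖matrixOp (M.map fun a => (Ψ a : H →L[ℂ] H))‖ = ‖matrixOp (M.map fun a => (a : H →L[ℂ] H))‖

end WeakStar

/-! ### The Fock space and the shift operators -/

variable {n m : ℕ}

/-- The Fock space `⨁_{k,l} E^{⊗k} ⊗ F^{⊗l}` with `E = ℂⁿ`, `F = ℂᵐ`, realised through its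
orthonormal basis `e_{a₁} ⊗ ⋯ ⊗ e_{aₖ} ⊗ f_{b₁} ⊗ ⋯ ⊗ f_{bₗ}`, which is indexed by the pairs
of words `(a, b)`. -/
abbrev Fock (n m : ℕ) : Type := ℓ²(List (Fin n) × List (Fin m), ℂ)

/-- The basis vector `e_{a₁} ⊗ ⋯ ⊗ e_{aₖ} ⊗ f_{b₁} ⊗ ⋯ ⊗ f_{bₗ}`. -/
def basisVec (a : List (Fin n)) (b : List (Fin m)) : Fock n m := lp.single 2 (a, b) (1 : ℂ)

theorem inner_basisVec (a : List (Fin n)) (b : List (Fin m)) (x : Fock n m) :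
    inner ℂ (basisVec a b) x = x (a, b) := by
  rw [basisVec, lp.inner_single_left]; simp

theorem orthonormal_basisVec :
    Orthonormal ℂ (fun p : List (Fin n) × List (Fin m) => basisVec p.1 p.2) := by
  rw [orthonormal_iff_ite]
  intro p q
  rw [inner_basisVec, basisVec, lp.single_apply, Pi.single_apply]

/-- The isometry of the Fock space that sends the basis to a given orthonormal family. -/
def ofOrthonormal (v : List (Fin n) × List (Fin m) → Fock n m) (hv : Orthonormal ℂ v) :
    Fock n m →ₗᵢ[ℂ] Fock n m :=
  hv.orthogonalFamily.linearIsometry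

theorem ofOrthonormal_basisVec (v : List (Fin n) × List (Fin m) → Fock n m)
    (hv : Orthonormal ℂ v) (a : List (Fin n)) (b : List (Fin m)) :
    ofOrthonormal v hv (basisVec a b) = v (a, b) := by
  rw [ofOrthonormal, basisVec, OrthogonalFamily.linearIsometry_apply_single]
  simp

theorem orthonormal_consE (i : Fin n) :
    Orthonormal ℂ (fun p : List (Fin n) × List (Fin m) => basisVec (i :: p.1) p.2) :=
  orthonormal_basisVec.comp (fun p : List (Fin n) × List (Fin m) => (i :: p.1, p.2))
    fun p q h => by
      simp only [Prod.mk.injEq, List.cons.injEq, true_and] at h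
      exact Prod.ext h.1 h.2

/-- The shift `L_{e_i}`, as an isometry: `e_a ⊗ f_b ↦ e_i ⊗ e_a ⊗ f_b`. -/
def shiftE (i : Fin n) : Fock n m →ₗᵢ[ℂ] Fock n m :=
  ofOrthonormal (fun p => basisVec (i :: p.1) p.2) (orthonormal_consE i)

theorem shiftE_basisVec (i : Fin n) (a : List (Fin n)) (b : List (Fin m)) :
    shiftE i (basisVec a b) = basisVec (i :: a) b :=
  ofOrthonormal_basisVec _ _ a b

/-- The vector `f_l ⊗ e_{a₁} ⊗ ⋯ ⊗ e_{aₖ} ⊗ f_b` of the Fock space, rewritten in the basis by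
successive applications of `f_l ⊗ e_k = ∑_{i,j} conj u_{(i,j),(k,l)} e_i ⊗ f_j`. -/
def pushF (u : Matrix (Fin n × Fin m) (Fin n × Fin m) ℂ) :
    Fin m → List (Fin n) → List (Fin m) → Fock n m
  | l, [], b => basisVec [] (l :: b)
  | l, k :: a, b => ∑ p : Fin n × Fin m, conj (u p (k, l)) • shiftE p.1 (pushF u p.2 a b)

theorem inner_shiftE_eq_zero (i : Fin n) (x y : Fock n m)
    (h : ∀ a b, inner ℂ y (basisVec (i :: a) b) = 0) : inner ℂ y (shiftE i x) = 0 := by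
  have h1 := ((orthonormal_consE (m := m) i).orthogonalFamily.hasSum_linearIsometry x).mapL
    (innerSL ℂ y)
  have h2 : ∀ p : List (Fin n) × List (Fin m), innerSL ℂ y
      (LinearIsometry.toSpanSingleton ℂ (Fock n m) ((orthonormal_consE (m := m) i).1 p) (x p))
        = 0 := by
    intro p
    simp [h]
  simp only [h2] at h1
  exact h1.unique hasSum_zero

theorem inner_basisVec_basisVec (a a' : List (Fin n)) (b b' : List (Fin m)) :
    inner ℂ (basisVec a b) (basisVec a' b') = if a = a' ∧ b = b' then (1 : ℂ) else 0 := by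
  simpa using (orthonormal_iff_ite.1 (orthonormal_basisVec (n := n) (m := m))) (a, b) (a', b')

theorem shiftE_apply_nil (i : Fin n) (x : Fock n m) (b : List (Fin m)) :
    shiftE i x ([], b) = 0 := by
  rw [← inner_basisVec]
  exact inner_shiftE_eq_zero i x _ fun a b' => by simp [inner_basisVec_basisVec]

theorem inner_shiftE (i j : Fin n) (x y : Fock n m) :
    inner ℂ (shiftE i x) (shiftE j y) = if i = j then inner ℂ x y else 0 := by
  split_ifs with hij
  · subst hij; exact (shiftE i).inner_map_map x y
  · refine inner_shiftE_eq_zero j y _ fun a b => inner_eq_zero_symm.1 ?_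
    refine inner_shiftE_eq_zero i x _ fun a' b' => ?_
    simp [inner_basisVec_basisVec, Ne.symm hij]

theorem inner_pushF {u : Matrix (Fin n × Fin m) (Fin n × Fin m) ℂ}
    (hu : u ∈ Matrix.unitaryGroup (Fin n × Fin m) ℂ) :
    ∀ (a a' : List (Fin n)) (l l' : Fin m) (b b' : List (Fin m)),
      inner ℂ (pushF u l a b) (pushF u l' a' b') =
        if l = l' ∧ a = a' ∧ b = b' then (1 : ℂ) else 0
  | [], [], l, l', b, b' => by
    simp only [pushF]
    rw [inner_basisVec, basisVec, lp.single_apply, Pi.single_apply]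
    simp
  | [], k' :: a', l, l', b, b' => by
    simp only [pushF]
    simp [inner_basisVec, shiftE_apply_nil]
  | k :: a, [], l, l', b, b' => by
    rw [inner_eq_zero_symm.1]
    · simp
    · simp only [pushF]
      simp [inner_sum, inner_smul_right, inner_basisVec, shiftE_apply_nil]
  | k :: a, k' :: a', l, l', b, b' => by
    have hs : ∑ p : Fin n × Fin m, conj (u p (k', l')) * u p (k, l) =
        if (k', l') = (k, l) then 1 else 0 := by
      have := congrFun (congrFun (Matrix.mem_unitaryGroup_iff'.1 hu) (k', l')) (k, l)
      simpa [Matrix.mul_apply, Matrix.star_apply, Matrix.one_apply] using this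
    have ih := inner_pushF hu a a'
    simp only [pushF, sum_inner, inner_sum, inner_smul_left, inner_smul_right, inner_shiftE, ih,
      RCLike.conj_conj]
    have hd : ∀ p q : Fin n × Fin m,
        (u q (k, l) * if q.1 = p.1 then
          (if q.2 = p.2 ∧ a = a' ∧ b = b' then (1 : ℂ) else 0) else 0) =
        if q = p then (if a = a' ∧ b = b' then u p (k, l) else 0) else 0 := by
      intro p q
      by_cases h : q = p
      · subst h; split_ifs <;> simp_all
      · have : ¬ (q.1 = p.1 ∧ q.2 = p.2) := fun h' => h (Prod.ext h'.1 h'.2)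
        split_ifs <;> simp_all
    simp only [hd, Finset.sum_ite_eq', Finset.mem_univ, if_true]
    by_cases h : a = a' ∧ b = b'
    · simp only [h, and_self, if_true, hs]
      simp [eq_comm, and_comm]
    · rw [if_neg (fun h' => h ⟨(List.cons.inj h'.2.1).2, h'.2.2⟩)]
      simp [h]

theorem orthonormal_pushF (u : Matrix.unitaryGroup (Fin n × Fin m) ℂ) (l : Fin m) :
    Orthonormal ℂ (fun p : List (Fin n) × List (Fin m) => pushF u.1 l p.1 p.2) := by
  rw [orthonormal_iff_ite]
  intro p q
  rw [inner_pushF u.2]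
  simp [Prod.ext_iff]

/-- The shift `L_{f_l}`, as an isometry: `e_a ⊗ f_b ↦ f_l ⊗ e_a ⊗ f_b`. -/
def shiftF (u : Matrix.unitaryGroup (Fin n × Fin m) ℂ) (l : Fin m) : Fock n m →ₗᵢ[ℂ] Fock n m :=
  ofOrthonormal (fun p => pushF u.1 l p.1 p.2) (orthonormal_pushF u l)

/-! ### The algebras -/

/-- The shift operator `L_{e_i}`. -/
def Le (i : Fin n) : Fock n m →L[ℂ] Fock n m := (shiftE i).toContinuousLinearMap

/-- The shift operator `L_{f_j}`. -/
def Lf (u : Matrix.unitaryGroup (Fin n × Fin m) ℂ) (j : Fin m) : Fock n m →L[ℂ] Fock n m :=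
  (shiftF u j).toContinuousLinearMap

/-- The unital algebra `ℂ[𝔽ᵤ⁺]` generated by the shifts. -/
def polyAlg (u : Matrix.unitaryGroup (Fin n × Fin m) ℂ) :
    Subalgebra ℂ (Fock n m →L[ℂ] Fock n m) :=
  Algebra.adjoin ℂ (Set.range Le ∪ Set.range (Lf u))

/-- The algebra `𝒜ᵤ`, the norm closure of `ℂ[𝔽ᵤ⁺]`. -/
def normAlg (u : Matrix.unitaryGroup (Fin n × Fin m) ℂ) :
    Subalgebra ℂ (Fock n m →L[ℂ] Fock n m) :=
  (polyAlg u).topologicalClosure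

/-- The algebra `ℒᵤ`, the weak-* closure of `ℂ[𝔽ᵤ⁺]`. -/
def wstarAlg (u : Matrix.unitaryGroup (Fin n × Fin m) ℂ) :
    Subalgebra ℂ (Fock n m →L[ℂ] Fock n m) :=
  weakStarClosure (polyAlg u)

theorem polyAlg_le_normAlg (u : Matrix.unitaryGroup (Fin n × Fin m) ℂ) :
    polyAlg u ≤ normAlg u := Subalgebra.le_topologicalClosure _

theorem polyAlg_le_wstarAlg (u : Matrix.unitaryGroup (Fin n × Fin m) ℂ) :
    polyAlg u ≤ wstarAlg u :=
  @Subalgebra.le_topologicalClosure ℂ _ (Fock n m →L[ℂ] Fock n m) (weakStar (Fock n m)) _ _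
    isSemitopologicalSemiring_weakStar _

theorem Le_mem (u : Matrix.unitaryGroup (Fin n × Fin m) ℂ) (i : Fin n) : Le i ∈ polyAlg u :=
  Algebra.subset_adjoin (Or.inl ⟨i, rfl⟩)

theorem Lf_mem (u : Matrix.unitaryGroup (Fin n × Fin m) ℂ) (j : Fin m) : Lf u j ∈ polyAlg u :=
  Algebra.subset_adjoin (Or.inr ⟨j, rfl⟩)

/-! ### Characters, the core, and the action of automorphisms -/

/-- `ℂⁿ × ℂᵐ`, each factor with its Euclidean norm. -/
abbrev Pt (n m : ℕ) : Type := EuclideanSpace ℂ (Fin n) × EuclideanSpace ℂ (Fin m)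

/-- The product `𝔹ₙ × 𝔹ₘ` of open unit balls. -/
def openBalls (n m : ℕ) : Set (Pt n m) := Metric.ball 0 1 ×ˢ Metric.ball 0 1

/-- The product of closed unit balls. -/
def closedBalls (n m : ℕ) : Set (Pt n m) := Metric.closedBall 0 1 ×ˢ Metric.closedBall 0 1

/-- The `n × m` matrix `C_{(i,j)} = u_{(i,j)} - E_{i,j}`, where `u_{(i,j)}` has the `(k,l)` entry
`u_{(i,j),(k,l)}`. -/
def cMat (u : Matrix.unitaryGroup (Fin n × Fin m) ℂ) (i : Fin n) (j : Fin m) :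
    Matrix (Fin n) (Fin m) ℂ :=
  Matrix.of (fun k l => u.1 (i, j) (k, l)) - Matrix.single i j 1

/-- The core `Ωᵤ⁰`. -/
def core (u : Matrix.unitaryGroup (Fin n × Fin m) ℂ) : Set (Pt n m) :=
  {p | p ∈ closedBalls n m ∧ ∀ i j,
    Matrix.mulVec (cMat u i j) p.2 = 0 ∧ Matrix.mulVec (cMat u i j).transpose p.1 = 0}

/-- The point `(φ(L_{e_i}))_i, (φ(L_{f_j}))_j` given by a unital linear multiplicative functional
on an algebra that contains the shifts. -/
def charPoint (u : Matrix.unitaryGroup (Fin n × Fin m) ℂ)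
    {A : Subalgebra ℂ (Fock n m →L[ℂ] Fock n m)} (hA : polyAlg u ≤ A) (φ : A →ₐ[ℂ] ℂ) : Pt n m :=
  (WithLp.toLp 2 fun i => φ ⟨Le i, hA (Le_mem u i)⟩,
    WithLp.toLp 2 fun j => φ ⟨Lf u j, hA (Lf_mem u j)⟩)

/-- `θ_Ψ(p) = q` for an algebraic automorphism `Ψ` of `𝒜ᵤ`: the character of `𝒜ᵤ` with point `p`
is taken by `φ ↦ φ ∘ Ψ⁻¹` to the character with point `q`. (A character of the Banach algebra `𝒜ᵤ`
is automatically continuous, hence determined by its point.) -/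
def Moves (u : Matrix.unitaryGroup (Fin n × Fin m) ℂ) (Ψ : normAlg u ≃ₐ[ℂ] normAlg u)
    (p q : Pt n m) : Prop :=
  ∃ φ : normAlg u →ₐ[ℂ] ℂ, charPoint u (polyAlg_le_normAlg u) φ = p ∧
    charPoint u (polyAlg_le_normAlg u) (φ.comp Ψ.symm.toAlgHom) = q

/-- `θ_Ψ(p) = q` for an automorphism `Ψ` of `ℒᵤ`: the weak-* continuous character of `ℒᵤ` with
point `p` is taken by `φ ↦ φ ∘ Ψ⁻¹` to the character with point `q`. -/
def WStarMoves (u : Matrix.unitaryGroup (Fin n × Fin m) ℂ) (Ψ : wstarAlg u ≃ₐ[ℂ] wstarAlg u)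
    (p q : Pt n m) : Prop :=
  ∃ φ : wstarAlg u →ₐ[ℂ] ℂ, @Continuous _ _ (weakStarOn (wstarAlg u)) _ φ ∧
    charPoint u (polyAlg_le_wstarAlg u) φ = p ∧
    charPoint u (polyAlg_le_wstarAlg u) (φ.comp Ψ.symm.toAlgHom) = q

/-- The automorphism `Ψ` of `ℒᵤ` is a homeomorphism for the weak-* topology. -/
def IsWStarHomeo (u : Matrix.unitaryGroup (Fin n × Fin m) ℂ)
    (Ψ : wstarAlg u ≃ₐ[ℂ] wstarAlg u) : Prop :=
  @IsHomeomorph _ _ (weakStarOn (wstarAlg u)) (weakStarOn (wstarAlg u)) Ψ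

/-- The automorphism `Ψ` of `ℒᵤ` restricts to an automorphism of `𝒜ᵤ`, i.e. `Ψ(𝒜ᵤ) = 𝒜ᵤ`. -/
def RestrictsToNormAlg (u : Matrix.unitaryGroup (Fin n × Fin m) ℂ)
    (Ψ : wstarAlg u ≃ₐ[ℂ] wstarAlg u) : Prop :=
  ∀ x : wstarAlg u, (Ψ x : Fock n m →L[ℂ] Fock n m) ∈ normAlg u ↔
    (x : Fock n m →L[ℂ] Fock n m) ∈ normAlg u

/-- The orbit of `(0, 0)` under the maps `θ_Ψ`, where `Ψ` runs through the automorphisms of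
`𝒜ᵤ`. -/
def originOrbit (u : Matrix.unitaryGroup (Fin n × Fin m) ℂ) : Set (Pt n m) :=
  {p | ∃ Ψ : normAlg u ≃ₐ[ℂ] normAlg u, Moves u Ψ 0 p}

end UnitaryRelation

end

noncomputable section

namespace UnitaryRelation


/-! ### Basic facts on the Fock space -/

section Basic

variable {n m : ℕ}

/-! The core consists of the pairs `(z, w)` for which `u` fixes all vectors `z ⊗ f_l` and `e_k ⊗ w`.

From core to automorphism. For a row isometry `L` and `‖z‖ < 1`, the Möbius transform of `L` at `z`
is again a row isometry (`isRowIsometry_moebius`). At a core point the combination `∑ conj z_k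
L_{e_k}` commutes with every `L_{f_l}`, and symmetrically for `w`, so the transformed shifts satisfy
the same commutation relations (`moebius_mul_moebius`). Normalised resolvents applied to the vacuum
give a wandering vector for them (`isWandering_moebius`), and the universal property of the Fock
space yields an isometry `U` that intertwines the two families. Its range is invariant under the
shifts and contains the vacuum, so `U` is unitary (`exists_core_unitary`). Conjugation by `U`
preserves both algebras, and the vacuum character is carried to `(z, w)`.

From automorphism to core. Division with remainder (`exists_factorization`) shows that at a point of
the open balls a character is determined by its point and a point derivation by its values on the
generators. At the origin these values are arbitrary. An automorphism transports derivations, and a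
dimension count makes the values arbitrary at `(z, w)` as well. Applying such derivations to `e_i
f_j = ∑ u f_l e_k` gives exactly the core equations (`mem_core_of_moves`).

The orbit stays in the open balls by the maximum principle along the gauge action
(`character_ne_one`): otherwise a contraction vanishing at the origin would take the value `1` at
the image of the origin, and a holomorphic function on the disc attaining its maximum at the centre
would be constant, against its value at `1`. The relative interior is then convex geometry, since
the core is a linear space cut by the closed balls. -/

theorem hasSum_basisVec (x : Fock n m) :
    HasSum (fun p : List (Fin n) × List (Fin m) => x p • basisVec p.1 p.2) x := by
  have h := lp.hasSum_single (p := 2) (by simp) x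
  refine h.congr_fun fun p => ?_
  rw [basisVec, ← lp.single_smul]
  simp

/-- A bounded operator on the Fock space is determined by its values on the basis. -/
theorem clm_ext_basisVec {H : Type*} [NormedAddCommGroup H] [NormedSpace ℂ H]
    {S T : Fock n m →L[ℂ] H} (h : ∀ a b, S (basisVec a b) = T (basisVec a b)) : S = T := by
  ext x
  have h1 := (hasSum_basisVec x).mapL S
  have h2 := (hasSum_basisVec x).mapL T
  simp only [map_smul, h] at h1 h2
  exact h1.unique h2

theorem apply_mem_of_basisVec {H : Type*} [NormedAddCommGroup H] [NormedSpace ℂ H]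
    {S : Fock n m →L[ℂ] H} {K : Submodule ℂ H} (hK : IsClosed (K : Set H)) (x : Fock n m)
    (h : ∀ a b, x (a, b) = 0 ∨ S (basisVec a b) ∈ K) : S x ∈ K := by
  refine hK.mem_of_tendsto ((hasSum_basisVec x).mapL S) (Filter.Eventually.of_forall fun s => ?_)
  refine K.sum_mem fun p _ => ?_
  rw [map_smul]
  rcases h p.1 p.2 with h | h
  · rw [h]; simp
  · exact K.smul_mem _ h

theorem Le_basisVec (i : Fin n) (a : List (Fin n)) (b : List (Fin m)) :
    Le i (basisVec a b) = basisVec (i :: a) b := shiftE_basisVec i a b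

theorem Lf_basisVec (u : Matrix.unitaryGroup (Fin n × Fin m) ℂ) (l : Fin m) (a : List (Fin n))
    (b : List (Fin m)) : Lf u l (basisVec a b) = pushF u.1 l a b :=
  ofOrthonormal_basisVec _ (orthonormal_pushF u l) a b

theorem Lf_basisVec_nil (u : Matrix.unitaryGroup (Fin n × Fin m) ℂ) (l : Fin m)
    (b : List (Fin m)) : Lf u l (basisVec [] b) = basisVec [] (l :: b) := by
  rw [Lf_basisVec, pushF]

theorem star_Le_mul_Le (i j : Fin n) :
    star (Le i : Fock n m →L[ℂ] Fock n m) * Le j = if i = j then 1 else 0 := by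
  ext1 x
  refine ext_inner_left ℂ fun y => ?_
  rw [mul_apply_eq_comp, ContinuousLinearMap.star_eq_adjoint,
    ContinuousLinearMap.adjoint_inner_right]
  have := inner_shiftE i j y x
  refine this.trans ?_
  split_ifs <;> simp

theorem star_Lf_mul_Lf (u : Matrix.unitaryGroup (Fin n × Fin m) ℂ) (i j : Fin m) :
    star (Lf u i) * Lf u j = if i = j then 1 else 0 := by
  refine clm_ext_basisVec fun a b => ?_
  refine ext_inner_left ℂ fun y => ?_
  rw [mul_apply_eq_comp, ContinuousLinearMap.star_eq_adjoint,
    ContinuousLinearMap.adjoint_inner_right]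
  -- The vector `y` is still arbitrary; as a functional of `y` the claim reduces to basis vectors
  -- once more, where `inner_pushF` applies.
  have : ((innerSL ℂ (Lf u j (basisVec a b))).comp (Lf u i)) =
      (innerSL ℂ ((if i = j then 1 else 0 : Fock n m →L[ℂ] Fock n m) (basisVec a b))) := by
    refine clm_ext_basisVec fun a' b' => ?_
    simp only [ContinuousLinearMap.comp_apply, innerSL_apply_apply, Lf_basisVec]
    rw [inner_pushF u.2]
    by_cases h : i = j
    · simp [h, inner_basisVec_basisVec]
    · simp [h, Ne.symm h]
  have h2 := congrArg conj (DFunLike.congr_fun this y)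
  simpa only [ContinuousLinearMap.comp_apply, innerSL_apply_apply, inner_conj_symm] using h2

/-- The commutation relation `f_l e_k = ∑ conj u_{(i,j),(k,l)} e_i f_j`. -/
theorem Lf_mul_Le (u : Matrix.unitaryGroup (Fin n × Fin m) ℂ) (l : Fin m) (k : Fin n) :
    Lf u l * Le k = ∑ p : Fin n × Fin m, conj (u.1 p (k, l)) • (Le p.1 * Lf u p.2) := by
  refine clm_ext_basisVec fun a b => ?_
  rw [mul_apply_eq_comp, Le_basisVec, Lf_basisVec, pushF]
  simp only [sum_apply, smul_apply,
    mul_apply_eq_comp, Lf_basisVec]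
  rfl

/-- The commutation relation `e_i f_j = ∑ u_{(i,j),(k,l)} f_l e_k`. -/
theorem Le_mul_Lf (u : Matrix.unitaryGroup (Fin n × Fin m) ℂ) (i : Fin n) (j : Fin m) :
    Le i * Lf u j = ∑ q : Fin n × Fin m, u.1 (i, j) q • (Lf u q.2 * Le q.1) := by
  have hs : ∀ p : Fin n × Fin m, ∑ q, u.1 (i, j) q * conj (u.1 p q) =
      if (i, j) = p then 1 else 0 := by
    intro p
    have := congrFun (congrFun (Matrix.mem_unitaryGroup_iff.1 u.2) (i, j)) p
    simpa [Matrix.mul_apply, Matrix.star_apply, Matrix.one_apply] using this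
  simp only [Lf_mul_Le, Finset.smul_sum, smul_smul]
  rw [Finset.sum_comm]
  simp only [← Finset.sum_smul, Prod.mk.eta, hs]
  simp

theorem Le_apply_cons (i j : Fin n) (x : Fock n m) (a : List (Fin n)) (b : List (Fin m)) :
    Le i x (j :: a, b) = if i = j then x (a, b) else 0 := by
  rw [← inner_basisVec, ← Le_basisVec, ← ContinuousLinearMap.adjoint_inner_right,
    ← ContinuousLinearMap.star_eq_adjoint, ← mul_apply_eq_comp, star_Le_mul_Le]
  by_cases h : i = j
  · simp [h, inner_basisVec]
  · simp [h, Ne.symm h]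

theorem Le_apply_nil (i : Fin n) (x : Fock n m) (b : List (Fin m)) :
    Le i x ([], b) = 0 := shiftE_apply_nil i x b

/-- Moving `f_l` to the right past the `e` letters changes indices but keeps the number of `f`
letters, so no term is free of them. -/
theorem pushF_apply_nil (u : Matrix (Fin n × Fin m) (Fin n × Fin m) ℂ) :
    ∀ (a' : List (Fin n)) (l : Fin m) (b' : List (Fin m)) (a : List (Fin n)),
      pushF u l a' b' (a, []) = 0
  | [], l, b', a => by
    rw [pushF, ← inner_basisVec, inner_basisVec_basisVec]; simp
  | k :: a', l, b', a => by
    rw [pushF, ← inner_basisVec, inner_sum]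
    refine Finset.sum_eq_zero fun p _ => ?_
    rw [inner_smul_right, inner_basisVec]
    have h : ∀ y : Fock n m, (∀ c, y (c, []) = 0) → shiftE p.1 y (a, []) = 0 := by
      intro y hy
      cases a with
      | nil => exact shiftE_apply_nil _ _ _
      | cons j a =>
        refine (Le_apply_cons p.1 j y a []).trans ?_
        simp [hy]
    rw [h _ (pushF_apply_nil u a' p.2 b'), mul_zero]

theorem Lf_apply_nil (u : Matrix.unitaryGroup (Fin n × Fin m) ℂ) (l : Fin m) (x : Fock n m)
    (a : List (Fin n)) : Lf u l x (a, []) = 0 := by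
  have : (innerSL ℂ (basisVec a [] : Fock n m)).comp (Lf u l) = 0 := by
    refine clm_ext_basisVec fun a' b' => ?_
    simp [Lf_basisVec, inner_basisVec, pushF_apply_nil]
  simpa [inner_basisVec] using DFunLike.congr_fun this x

theorem star_Le_apply_basisVec_nil (i : Fin n) (b : List (Fin m)) :
    star (Le i : Fock n m →L[ℂ] Fock n m) (basisVec [] b) = 0 := by
  refine ext_inner_right ℂ fun y => ?_
  rw [ContinuousLinearMap.star_eq_adjoint, ContinuousLinearMap.adjoint_inner_left,
    inner_basisVec, Le_apply_nil, inner_zero_left]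

/-- The joint kernel of the `L_{e_i}^*` is invariant under the `L_{f_l}`. -/
theorem star_Le_Lf_eq_zero (u : Matrix.unitaryGroup (Fin n × Fin m) ℂ) (l : Fin m)
    {x : Fock n m} (hx : ∀ i : Fin n, star (Le i) x = 0) (i : Fin n) :
    star (Le i) (Lf u l x) = 0 := by
  have h := apply_mem_of_basisVec (S := star (Le i) * Lf u l) (K := ⊥)
    (by simp) x ?_
  · simpa using h
  · intro a b
    cases a with
    | nil =>
      right
      rw [mul_apply_eq_comp, Lf_basisVec_nil, star_Le_apply_basisVec_nil]; simp
    | cons j a =>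
      left
      rw [← inner_basisVec, ← Le_basisVec, ← ContinuousLinearMap.adjoint_inner_right,
        ← ContinuousLinearMap.star_eq_adjoint, hx, inner_zero_right]

theorem star_Lf_eq_zero (u : Matrix.unitaryGroup (Fin n × Fin m) ℂ) {x : Fock n m}
    (hx : ∀ a b, b ≠ [] → x (a, b) = 0) (l : Fin m) : star (Lf u l) x = 0 := by
  refine ext_inner_left ℂ fun y => ?_
  rw [ContinuousLinearMap.star_eq_adjoint, ContinuousLinearMap.adjoint_inner_right,
    inner_zero_right, lp.inner_eq_tsum]
  refine (tsum_congr fun p => ?_).trans tsum_zero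
  obtain ⟨a, b⟩ := p
  by_cases hb : b = []
  · subst hb; rw [Lf_apply_nil]; simp
  · rw [hx a b hb]; simp

/-- The vacuum vector. -/
def vac (n m : ℕ) : Fock n m := basisVec [] []

theorem norm_vac : ‖vac n m‖ = 1 := orthonormal_basisVec.1 ([], [])

theorem star_Le_vac (i : Fin n) : star (Le i) (vac n m) = 0 :=
  star_Le_apply_basisVec_nil i []

theorem star_Lf_vac (u : Matrix.unitaryGroup (Fin n × Fin m) ℂ) (l : Fin m) :
    star (Lf u l) (vac n m) = 0 := by
  refine star_Lf_eq_zero u (fun a b hb => ?_) l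
  rw [← inner_basisVec, vac, inner_basisVec_basisVec]
  simp [hb]

end Basic

/-! ### Möbius transforms of row isometries -/

section Moebius

variable {A : Type*} [CStarAlgebra A] {ι : Type*} [Fintype ι]

/-- The linear combination `∑ conj zᵢ Lᵢ`. -/
def rowComb (L : ι → A) (z : EuclideanSpace ℂ ι) : A := ∑ i, conj (z i) • L i

/-- The defect `√(1 - ‖z‖²)` as a complex number. -/
def defect (z : EuclideanSpace ℂ ι) : ℂ := (√(1 - ‖z‖ ^ 2) : ℝ)

/-- The resolvent `(1 - ∑ conj zᵢ Lᵢ)⁻¹`. -/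
def resolv (L : ι → A) (z : EuclideanSpace ℂ ι) : A := Ring.inverse (1 - rowComb L z)

/-- The scalar `zₖ / (1 + √(1 - ‖z‖²))`. -/
def halfPt (z : EuclideanSpace ℂ ι) (k : ι) : ℂ := z k / (1 + defect z)

/-- The Möbius transform of the row `L` at the point `z`. -/
def moebius (L : ι → A) (z : EuclideanSpace ℂ ι) (k : ι) : A :=
  -(halfPt z k • 1) + defect z • (resolv L z * (L k - halfPt z k • 1))

/-- The `Lᵢ` are isometries with orthogonal ranges. -/
def IsRowIsometry {ι : Type*} [DecidableEq ι] (L : ι → A) : Prop :=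
  ∀ i j, star (L i) * L j = if i = j then 1 else 0

theorem rowComb_neg (L : ι → A) (z : EuclideanSpace ℂ ι) : rowComb L (-z) = -rowComb L z := by
  simp [rowComb]

theorem defect_neg (z : EuclideanSpace ℂ ι) : defect (-z) = defect z := by simp [defect]

theorem halfPt_neg (z : EuclideanSpace ℂ ι) (k : ι) : halfPt (-z) k = -halfPt z k := by
  simp [halfPt, defect_neg, neg_div]

theorem conj_defect (z : EuclideanSpace ℂ ι) : conj (defect z) = defect z := by
  simp [defect]

theorem defect_pos {z : EuclideanSpace ℂ ι} (hz : ‖z‖ < 1) : 0 < √(1 - ‖z‖ ^ 2) :=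
  Real.sqrt_pos.2 (by nlinarith [norm_nonneg z])

theorem defect_ne_zero {z : EuclideanSpace ℂ ι} (hz : ‖z‖ < 1) : defect z ≠ 0 :=
  Complex.ofReal_ne_zero.2 (defect_pos hz).ne'

theorem defect_sq {z : EuclideanSpace ℂ ι} (hz : ‖z‖ < 1) :
    defect z ^ 2 = 1 - (‖z‖ : ℂ) ^ 2 := by
  rw [defect, ← Complex.ofReal_pow, Real.sq_sqrt (by nlinarith [norm_nonneg z])]
  push_cast; rfl

theorem one_add_defect_ne_zero (z : EuclideanSpace ℂ ι) : 1 + defect z ≠ 0 := by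
  have : (0 : ℝ) < 1 + √(1 - ‖z‖ ^ 2) := by positivity
  rw [defect]
  exact_mod_cast this.ne'

theorem eq_mul_halfPt (z : EuclideanSpace ℂ ι) (k : ι) :
    z k = (1 + defect z) * halfPt z k := by
  rw [halfPt, mul_div_cancel₀ _ (one_add_defect_ne_zero z)]

theorem sum_conj_mul_self (z : EuclideanSpace ℂ ι) :
    ∑ i, conj (z i) * z i = (‖z‖ : ℂ) ^ 2 := by
  rw [← Complex.ofReal_pow, EuclideanSpace.norm_sq_eq]
  push_cast
  exact Finset.sum_congr rfl fun i _ => by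
    rw [mul_comm, Complex.mul_conj, Complex.normSq_eq_norm_sq]; push_cast; rfl

theorem sum_conj_mul_halfPt {z : EuclideanSpace ℂ ι} (hz : ‖z‖ < 1) :
    ∑ i, conj (z i) * halfPt z i = 1 - defect z := by
  have h := one_add_defect_ne_zero z
  simp only [halfPt, ← mul_div_assoc, ← Finset.sum_div, sum_conj_mul_self]
  rw [div_eq_iff h]
  linear_combination defect_sq hz

theorem commute_resolv {L : ι → A} {z : EuclideanSpace ℂ ι} {T : A} (h : Commute T (rowComb L z)) :
    Commute T (resolv L z) := by
  have h' : Commute T (1 - rowComb L z) := (Commute.one_right T).sub_right h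
  by_cases hu : IsUnit (1 - rowComb L z)
  · obtain ⟨v, hv⟩ := hu
    rw [← hv] at h'
    rw [resolv, ← hv, Ring.inverse_unit]
    exact h'.units_inv_right
  · rw [resolv, Ring.inverse_non_unit _ hu]
    exact Commute.zero_right T

variable [DecidableEq ι] {L : ι → A}

theorem star_mul_rowComb (hL : IsRowIsometry L) (z : EuclideanSpace ℂ ι) (j : ι) :
    star (L j) * rowComb L z = conj (z j) • 1 := by
  simp [rowComb, Finset.mul_sum, hL j]

theorem star_rowComb_mul (hL : IsRowIsometry L) (z : EuclideanSpace ℂ ι) (j : ι) :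
    star (rowComb L z) * L j = z j • 1 := by
  have := congrArg star (star_mul_rowComb hL z j)
  simpa using this

theorem star_rowComb_mul_rowComb (hL : IsRowIsometry L) (z : EuclideanSpace ℂ ι) :
    star (rowComb L z) * rowComb L z = ((‖z‖ : ℂ) ^ 2) • 1 := by
  conv_lhs => rw [rowComb, Finset.mul_sum]
  simp only [mul_smul_comm]
  rw [← sum_conj_mul_self, Finset.sum_smul]
  refine Finset.sum_congr rfl fun i _ => ?_
  have := star_rowComb_mul hL z i
  rw [rowComb] at this
  rw [this, smul_smul]

theorem norm_rowComb_le (hL : IsRowIsometry L) (z : EuclideanSpace ℂ ι) :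
    ‖rowComb L z‖ ≤ ‖z‖ := by
  have h1 : ‖(1 : A)‖ ≤ 1 := by
    rcases subsingleton_or_nontrivial A with h | h
    · rw [Subsingleton.elim (1 : A) 0, norm_zero]; exact zero_le_one
    · rw [CStarRing.norm_one]
  have h2 := CStarRing.norm_star_mul_self (x := rowComb L z)
  rw [star_rowComb_mul_rowComb hL, norm_smul] at h2
  simp only [norm_pow, Complex.norm_real, norm_norm] at h2
  refine abs_le_of_sq_le_sq' ?_ (norm_nonneg _) |>.2
  nlinarith [sq_nonneg ‖z‖]

theorem isUnit_one_sub_rowComb (hL : IsRowIsometry L) {z : EuclideanSpace ℂ ι} (hz : ‖z‖ < 1) :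
    IsUnit (1 - rowComb L z) :=
  isUnit_one_sub_of_norm_lt_one ((norm_rowComb_le hL z).trans_lt hz)

theorem resolv_mul (hL : IsRowIsometry L) {z : EuclideanSpace ℂ ι} (hz : ‖z‖ < 1) :
    resolv L z * (1 - rowComb L z) = 1 :=
  Ring.inverse_mul_cancel _ (isUnit_one_sub_rowComb hL hz)

theorem mul_resolv (hL : IsRowIsometry L) {z : EuclideanSpace ℂ ι} (hz : ‖z‖ < 1) :
    (1 - rowComb L z) * resolv L z = 1 :=
  Ring.mul_inverse_cancel _ (isUnit_one_sub_rowComb hL hz)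

theorem rowComb_mul_resolv (hL : IsRowIsometry L) {z : EuclideanSpace ℂ ι} (hz : ‖z‖ < 1) :
    rowComb L z * resolv L z = resolv L z - 1 := by
  have := mul_resolv hL hz
  rw [sub_mul, one_mul] at this
  rw [← this]; abel

/-- With `W = rowComb L z` and `D` its resolvent, `W D = D - 1` while `W* W` is the scalar `‖z‖²`;
expanding `(W D)* (W D)` in both ways gives the identity. It makes every expression quadratic in `D`
linear. -/
theorem star_resolv_mul_resolv (hL : IsRowIsometry L) {z : EuclideanSpace ℂ ι} (hz : ‖z‖ < 1) :
    (defect z ^ 2) • (star (resolv L z) * resolv L z) =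
      resolv L z + star (resolv L z) - 1 := by
  have h1 := rowComb_mul_resolv hL hz
  have h2 := congrArg star h1
  rw [star_mul, star_sub, star_one] at h2
  have h3 : (star (resolv L z) * star (rowComb L z)) * (rowComb L z * resolv L z) =
      ((‖z‖ : ℂ) ^ 2) • (star (resolv L z) * resolv L z) := by
    rw [mul_assoc, ← mul_assoc (star (rowComb L z)), star_rowComb_mul_rowComb hL]
    simp
  rw [h1, h2] at h3
  rw [defect_sq hz, sub_smul, ← h3]
  simp only [sub_mul, mul_sub, one_smul, one_mul, mul_one]
  abel

theorem star_mul_resolv (hL : IsRowIsometry L) {z : EuclideanSpace ℂ ι} (hz : ‖z‖ < 1) (j : ι) :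
    star (L j) * resolv L z = star (L j) + conj (z j) • resolv L z := by
  have h1 : resolv L z = 1 + rowComb L z * resolv L z := by rw [rowComb_mul_resolv hL hz]; abel
  conv_lhs => rw [h1, mul_add, ← mul_assoc, star_mul_rowComb hL]
  simp

theorem star_resolv_mul (hL : IsRowIsometry L) {z : EuclideanSpace ℂ ι} (hz : ‖z‖ < 1) (j : ι) :
    star (resolv L z) * L j = L j + z j • star (resolv L z) := by
  have := congrArg star (star_mul_resolv hL hz j)
  simpa using this

/-- For a single isometry the transform is `(1 - conj z L)⁻¹ (L - z)`. In general the claim is a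
formal consequence of the relations between `L_j`, `L_k*`, `D` and `D*`. -/
theorem isRowIsometry_moebius (hL : IsRowIsometry L) {z : EuclideanSpace ℂ ι} (hz : ‖z‖ < 1) :
    IsRowIsometry (moebius L z) := by
  intro j k
  have hd := hL j k
  have hDD := star_resolv_mul_resolv hL hz
  have f1 := star_mul_resolv hL hz j
  have f2 := star_resolv_mul hL hz k
  have hs := conj_defect z
  -- Writing `z = (1 + s) c`, with `s` the defect and `c` the half point, removes all division; the
  -- rest is polynomial in `s`, `c` and the operators.
  have hzj := congrArg conj (eq_mul_halfPt z j)
  rw [map_mul, map_add, map_one, hs] at hzj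
  have hzk := eq_mul_halfPt z k
  rw [hzj] at f1
  rw [hzk] at f2
  simp only [moebius, star_add, star_neg, star_smul, star_mul, star_sub, star_one,
    RCLike.star_def, hs]
  generalize resolv L z = D at *
  generalize halfPt z k = c at *
  generalize halfPt z j = b at *
  generalize defect z = s at *
  generalize (if j = k then (1 : A) else 0) = d at *
  -- This is the only term containing `D* D`; `hDD` makes it linear in `D` and `D*`, after which it
  -- cancels the other terms up to `d`.
  have key : (s ^ 2) • ((star (L j) - conj b • 1) * (star D * D) * (L k - c • 1)) =
      d + (s * conj b) • (D * L k) - (s * conj b * c) • D + (s * c) • (star (L j) * star D)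
        - (s * conj b * c) • star D - (conj b * c) • 1 := by
    have e1 : (star (L j) - conj b • 1) * ((s ^ 2) • (star D * D)) =
        (s * conj b) • D + star (L j) * star D - conj b • star D + conj b • 1 := by
      rw [hDD, sub_mul, mul_sub, mul_add, f1]
      simp only [smul_mul_assoc, one_mul, mul_one]
      module
    have e2 : star (L j) * star D * L k = d + ((1 + s) * c) • (star (L j) * star D) := by
      rw [mul_assoc, f2, mul_add, hd, mul_smul_comm]
    rw [← smul_mul_assoc, ← mul_smul_comm, e1]
    simp only [add_mul, sub_mul, mul_sub, smul_mul_assoc, one_mul, mul_smul_comm, mul_one, e2, f2]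
    module
  have e3 : (-(conj b • 1) + s • ((star (L j) - conj b • 1) * star D)) *
      (-(c • 1) + s • (D * (L k - c • 1))) = (conj b * c) • (1 : A)
        - (s * conj b) • (D * L k) + (s * conj b * c) • D - (s * c) • (star (L j) * star D)
        + (s * conj b * c) • star D
        + (s ^ 2) • ((star (L j) - conj b • 1) * (star D * D) * (L k - c • 1)) := by
    simp only [add_mul, mul_add, sub_mul, mul_sub, smul_mul_assoc, one_mul, mul_smul_comm,
      mul_one, neg_mul, mul_neg, mul_assoc, smul_sub, smul_smul]
    module
  rw [e3, key]
  module

/-- In one variable this reads `conj z (L - z) / (1 - conj z L) = (1 - |z|²) / (1 - conj z L) - 1`.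
-/
theorem rowComb_moebius (hL : IsRowIsometry L) {z : EuclideanSpace ℂ ι} (hz : ‖z‖ < 1) :
    rowComb (moebius L z) z = (defect z ^ 2) • resolv L z - 1 := by
  have e : rowComb (moebius L z) z = -((∑ i, conj (z i) * halfPt z i) • (1 : A)) +
      defect z • (resolv L z * (rowComb L z - (∑ i, conj (z i) * halfPt z i) • 1)) := by
    simp only [rowComb, moebius, Finset.sum_smul, smul_add, Finset.sum_add_distrib, smul_neg,
      Finset.sum_neg_distrib, smul_smul, mul_sub, smul_sub, Finset.sum_sub_distrib,
      Finset.mul_sum, Finset.smul_sum, mul_smul_comm, mul_one]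
    congr 3 <;> exact funext fun i => by ring_nf
  have h := resolv_mul hL hz
  rw [mul_sub, mul_one] at h
  have h' : resolv L z * rowComb L z = resolv L z - 1 := by rw [← h]; abel
  rw [e, sum_conj_mul_halfPt hz, mul_sub, h']
  simp only [mul_smul_comm, mul_one]
  module

/-- Intertwining the row combinations and using `rowComb_moebius` gives `U (1 + W) = s² D U`, where
`1 + W` is the inverse of the resolvent at `-z`. Multiplying by inverses on both sides finishes. -/
theorem intertwine_resolv (hL : IsRowIsometry L) {z : EuclideanSpace ℂ ι} (hz : ‖z‖ < 1) {U : A}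
    (hU : ∀ k, U * L k = moebius L z k * U) :
    (1 - rowComb L z) * U = (defect z ^ 2) • (U * resolv L (-z)) := by
  have hz' : ‖-z‖ < 1 := by rwa [norm_neg]
  have h1 : U * rowComb L z = rowComb (moebius L z) z * U := by
    simp [rowComb, Finset.mul_sum, Finset.sum_mul, hU]
  rw [rowComb_moebius hL hz, sub_mul, one_mul] at h1
  have h2 : U * (1 - rowComb L (-z)) = (defect z ^ 2) • (resolv L z * U) := by
    rw [rowComb_neg, sub_neg_eq_add, mul_add, h1, mul_one, smul_mul_assoc]; abel
  have h3 := congrArg (fun X => (1 - rowComb L z) * X * resolv L (-z)) h2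
  simp only [mul_assoc, mul_smul_comm, smul_mul_assoc, mul_resolv hL hz', mul_one] at h3
  rw [h3, ← mul_assoc, mul_resolv hL hz, one_mul]

/-- If `U` intertwines `L` with its Möbius transform at `z`, then it intertwines the Möbius
transform at `-z` with `L`. -/
theorem intertwine_neg (hL : IsRowIsometry L) {z : EuclideanSpace ℂ ι} (hz : ‖z‖ < 1) {U : A}
    (hU : ∀ k, U * L k = moebius L z k * U) (k : ι) :
    L k * U = U * moebius L (-z) k := by
  have h1 := intertwine_resolv hL hz hU
  -- The definition of the Möbius transform solved for `L_k`, so that `L_k U` can be rewritten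
  -- through `moebius L z k * U = U * L k`.
  have h2 : defect z • L k = (1 - rowComb L z) * moebius L z k +
      halfPt z k • (1 - rowComb L z) + (defect z * halfPt z k) • 1 := by
    rw [moebius, mul_add, mul_smul_comm, ← mul_assoc, mul_resolv hL hz]
    simp only [mul_neg, mul_smul_comm, mul_one, one_mul]
    module
  have h3 : defect z • (L k * U) = defect z • (U * moebius L (-z) k) := by
    rw [← smul_mul_assoc, h2, add_mul, add_mul, mul_assoc, ← hU, ← mul_assoc, smul_mul_assoc, h1,
      moebius, defect_neg, halfPt_neg]
    simp only [mul_add, smul_mul_assoc, mul_smul_comm, mul_sub, mul_one, one_mul, mul_neg,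
      neg_smul, mul_assoc]
    module
  exact smul_right_injective A (defect_ne_zero hz) h3

/-- The right side annihilates every vector killed by all `L_i*`, because `D*` fixes such vectors.
Hence `D` sends wandering vectors of `L` to wandering vectors of the transform. -/
theorem star_moebius_mul_resolv (hL : IsRowIsometry L) {z : EuclideanSpace ℂ ι} (hz : ‖z‖ < 1)
    (k : ι) : defect z • (star (moebius L z k) * resolv L z) =
      star (L k) * star (resolv L z) - conj (halfPt z k) • (star (resolv L z) - 1) := by
  have hDD := star_resolv_mul_resolv hL hz
  have f1 := star_mul_resolv hL hz k
  have hs := conj_defect z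
  have hzj := congrArg conj (eq_mul_halfPt z k)
  rw [map_mul, map_add, map_one, hs] at hzj
  rw [hzj] at f1
  have e : defect z • (star (moebius L z k) * resolv L z) =
      -((defect z * conj (halfPt z k)) • resolv L z) + (star (L k) - conj (halfPt z k) • 1) *
        ((defect z ^ 2) • (star (resolv L z) * resolv L z)) := by
    simp only [moebius, star_add, star_neg, star_smul, star_mul, star_sub, star_one,
      RCLike.star_def, hs, add_mul, sub_mul, smul_mul_assoc, mul_smul_comm, mul_assoc, one_mul,
      neg_mul]
    module
  rw [e, hDD]
  simp only [sub_mul, mul_sub, mul_add, f1, smul_mul_assoc, one_mul, mul_one]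
  module

end Moebius

/-! ### Joint kernels of the adjoints -/

section Kernel

variable {H : Type*} [NormedAddCommGroup H] [InnerProductSpace ℂ H] [CompleteSpace H]
  {ι : Type*} [Fintype ι] {L : ι → H →L[ℂ] H}

theorem star_rowComb_apply_eq_zero {z : EuclideanSpace ℂ ι}
    {x : H} (hx : ∀ i, star (L i) x = 0) : star (rowComb L z) x = 0 := by
  simp only [rowComb, star_sum, star_smul, sum_apply, smul_apply, hx, smul_zero,
    Finset.sum_const_zero]

variable [DecidableEq ι]

theorem star_resolv_apply (hL : IsRowIsometry L) {z : EuclideanSpace ℂ ι} (hz : ‖z‖ < 1)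
    {x : H} (hx : ∀ i, star (L i) x = 0) : star (resolv L z) x = x := by
  have h := congrArg star (mul_resolv hL hz)
  rw [star_mul, star_one, star_sub, star_one] at h
  have h2 := DFunLike.congr_fun h x
  simpa [star_rowComb_apply_eq_zero hx] using h2

theorem star_moebius_resolv_apply (hL : IsRowIsometry L) {z : EuclideanSpace ℂ ι} (hz : ‖z‖ < 1)
    {x : H} (hx : ∀ i, star (L i) x = 0) (k : ι) :
    star (moebius L z k) (resolv L z x) = 0 := by
  have h := DFunLike.congr_fun (star_moebius_mul_resolv hL hz k) x
  simp only [smul_apply, sub_apply, mul_apply_eq_comp, star_resolv_apply hL hz hx, hx,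
    one_apply_eq_self, sub_self, smul_zero] at h
  exact (smul_eq_zero.1 h).resolve_left (defect_ne_zero hz)

/-- On the joint kernel `D*` is the identity, so `s² D* D = D + D* - 1` acts there as `D`, and `⟨x,
D y⟩ = ⟨D* x, y⟩ = ⟨x, y⟩`. -/
theorem inner_resolv_resolv (hL : IsRowIsometry L) {z : EuclideanSpace ℂ ι} (hz : ‖z‖ < 1)
    {x y : H} (hx : ∀ i, star (L i) x = 0) (hy : ∀ i, star (L i) y = 0) :
    inner ℂ (defect z • resolv L z x) (defect z • resolv L z y) = inner ℂ x y := by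
  have h := DFunLike.congr_fun (star_resolv_mul_resolv hL hz) y
  simp only [smul_apply, sub_apply, add_apply, mul_apply_eq_comp, star_resolv_apply hL hz hy,
    one_apply_eq_self, add_sub_cancel_right] at h
  rw [inner_smul_left, inner_smul_right, conj_defect, ← mul_assoc, ← sq, ← inner_smul_right,
    ← map_smul, ← ContinuousLinearMap.adjoint_inner_right, ← ContinuousLinearMap.star_eq_adjoint,
    map_smul, map_smul, h, ← ContinuousLinearMap.adjoint_inner_left,
    ← ContinuousLinearMap.star_eq_adjoint, star_resolv_apply hL hz hx]

end Kernel

/-! ### Intertwining isometries -/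

section Words

variable {H : Type*} [NormedAddCommGroup H] [InnerProductSpace ℂ H] [CompleteSpace H]
  {ι : Type*} [DecidableEq ι]

/-- Equal first letters cancel, different ones are orthogonal, and a letter left over on one side
has an adjoint that kills the vector on the other. -/
theorem inner_word_word {X : ι → H →L[ℂ] H} (hX : IsRowIsometry X) {x y : H}
    (hx : ∀ k, star (X k) x = 0) (hy : ∀ k, star (X k) y = 0) :
    ∀ a b : List ι, inner ℂ ((a.map X).prod x) ((b.map X).prod y) =
      if a = b then inner ℂ x y else 0
  | [], [] => by simp
  | [], k :: b => by
    simp only [List.map_nil, List.prod_nil, List.map_cons, List.prod_cons, mul_apply_eq_comp,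
      one_apply_eq_self]
    rw [← ContinuousLinearMap.adjoint_inner_left, ← ContinuousLinearMap.star_eq_adjoint, hx]
    simp
  | k :: a, [] => by
    simp only [List.map_nil, List.prod_nil, List.map_cons, List.prod_cons, mul_apply_eq_comp,
      one_apply_eq_self]
    rw [← ContinuousLinearMap.adjoint_inner_right, ← ContinuousLinearMap.star_eq_adjoint, hy]
    simp
  | k :: a, l :: b => by
    simp only [List.map_cons, List.prod_cons, mul_apply_eq_comp]
    rw [← ContinuousLinearMap.adjoint_inner_right, ← ContinuousLinearMap.star_eq_adjoint,
      ← mul_apply_eq_comp, hX]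
    by_cases h : k = l
    · simp [h, inner_word_word hX hx hy a b]
    · simp [h]

end Words

section Wold

variable {n m : ℕ}

theorem isRowIsometry_Le : IsRowIsometry (Le : Fin n → Fock n m →L[ℂ] Fock n m) :=
  star_Le_mul_Le

theorem isRowIsometry_Lf (u : Matrix.unitaryGroup (Fin n × Fin m) ℂ) : IsRowIsometry (Lf u) :=
  star_Lf_mul_Lf u

/-- Row isometries `V`, `Y` that satisfy the commutation relations of `u`, together with a
wandering unit vector `ξ`. -/
structure IsWandering (u : Matrix.unitaryGroup (Fin n × Fin m) ℂ)
    (V : Fin n → Fock n m →L[ℂ] Fock n m) (Y : Fin m → Fock n m →L[ℂ] Fock n m)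
    (ξ : Fock n m) : Prop where
  rowE : IsRowIsometry V
  rowF : IsRowIsometry Y
  rel : ∀ l k, Y l * V k = ∑ p : Fin n × Fin m, conj (u.1 p (k, l)) • (V p.1 * Y p.2)
  norm_eq : ‖ξ‖ = 1
  kerF : ∀ l, star (Y l) ξ = 0
  kerE : ∀ k (b : List (Fin m)), star (V k) ((b.map Y).prod ξ) = 0

theorem basisVec_eq (u : Matrix.unitaryGroup (Fin n × Fin m) ℂ) (a : List (Fin n))
    (b : List (Fin m)) :
    basisVec a b = (a.map Le).prod ((b.map (Lf u)).prod (vac n m)) := by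
  induction a with
  | nil =>
    induction b with
    | nil => rfl
    | cons l b ih =>
      rw [List.map_cons, List.prod_cons, List.map_nil, List.prod_nil, mul_apply_eq_comp]
      rw [List.map_nil, List.prod_nil, one_apply_eq_self] at ih
      rw [← ih, one_apply_eq_self, Lf_basisVec_nil]
  | cons k a ih => rw [List.map_cons, List.prod_cons, mul_apply_eq_comp, ← ih, Le_basisVec]

/-- Universal property of the Fock space: `e_a ⊗ f_b ↦ V_a Y_b ξ`. Orthonormality follows by
cancelling first the `V` words, whose base vectors `Y_b ξ` lie in the joint kernel by `kerE`, and
then the `Y` words. -/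
theorem IsWandering.exists_intertwiner {u : Matrix.unitaryGroup (Fin n × Fin m) ℂ}
    {V : Fin n → Fock n m →L[ℂ] Fock n m} {Y : Fin m → Fock n m →L[ℂ] Fock n m}
    {ξ : Fock n m} (h : IsWandering u V Y ξ) :
    ∃ U : Fock n m →L[ℂ] Fock n m, star U * U = 1 ∧ (∀ k, U * Le k = V k * U) ∧
      (∀ l, U * Lf u l = Y l * U) ∧ U (vac n m) = ξ := by
  have hv : Orthonormal ℂ (fun p : List (Fin n) × List (Fin m) =>
      (p.1.map V).prod ((p.2.map Y).prod ξ)) := by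
    rw [orthonormal_iff_ite]
    rintro ⟨a, b⟩ ⟨a', b'⟩
    simp only
    rw [inner_word_word h.rowE (h.kerE · b) (h.kerE · b'), inner_word_word h.rowF h.kerF h.kerF]
    have : inner ℂ ξ ξ = 1 := by rw [inner_self_eq_norm_sq_to_K, h.norm_eq]; simp
    rw [this]
    by_cases h1 : a = a' <;> by_cases h2 : b = b' <;> simp [h1, h2]
  set U : Fock n m →L[ℂ] Fock n m := (ofOrthonormal _ hv).toContinuousLinearMap with hU
  have hb : ∀ a b, U (basisVec a b) = (a.map V).prod ((b.map Y).prod ξ) := fun a b =>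
    ofOrthonormal_basisVec _ hv a b
  have hE : ∀ k, U * Le k = V k * U := fun k => clm_ext_basisVec fun a b => by
    rw [mul_apply_eq_comp, mul_apply_eq_comp, Le_basisVec, hb, hb, List.map_cons, List.prod_cons,
      mul_apply_eq_comp]
  -- Each commutation exchanges the letters, so the induction on `a` must keep `l` universally
  -- quantified.
  have hF : ∀ (a : List (Fin n)) (b : List (Fin m)) (l : Fin m),
      U (Lf u l (basisVec a b)) = Y l (U (basisVec a b)) := by
    intro a b
    induction a with
    | nil =>
      intro l
      rw [Lf_basisVec_nil, hb, hb]
      simp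
    | cons k a ih =>
      intro l
      rw [← Le_basisVec, ← mul_apply_eq_comp (Lf u l), Lf_mul_Le]
      simp only [sum_apply, smul_apply, map_sum, map_smul, mul_apply_eq_comp]
      simp only [← mul_apply_eq_comp U, hE]
      simp only [mul_apply_eq_comp, ih]
      rw [← mul_apply_eq_comp (Y l), h.rel]
      simp [sum_apply]
  refine ⟨U, ?_, hE, fun l => clm_ext_basisVec fun a b => hF a b l, ?_⟩
  · exact (ContinuousLinearMap.norm_map_iff_adjoint_comp_self U).1
      (ofOrthonormal _ hv).norm_map
  · rw [vac, hb]; simp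

/-- The range of `U` is invariant under all shifts and contains the vacuum, hence contains every
basis vector; on the range, `U U*` is the identity. -/
theorem mul_star_eq_one_of_invariant {u : Matrix.unitaryGroup (Fin n × Fin m) ℂ}
    {U : Fock n m →L[ℂ] Fock n m} (hU : star U * U = 1)
    {V : Fin n → Fock n m →L[ℂ] Fock n m} {Y : Fin m → Fock n m →L[ℂ] Fock n m}
    (hV : ∀ k, Le k * U = U * V k) (hY : ∀ l, Lf u l * U = U * Y l) {x : Fock n m}
    (hx : U x = vac n m) : U * star U = 1 := by
  have hb : ∀ b : List (Fin m), ∃ y, U y = (b.map (Lf u)).prod (vac n m) := by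
    intro b
    induction b with
    | nil => exact ⟨x, by simpa using hx⟩
    | cons l b ih =>
      obtain ⟨y, hy⟩ := ih
      refine ⟨Y l y, ?_⟩
      rw [List.map_cons, List.prod_cons, mul_apply_eq_comp, ← hy, ← mul_apply_eq_comp,
        ← mul_apply_eq_comp, hY]
  have ha : ∀ (a : List (Fin n)) (b : List (Fin m)), ∃ y, U y = basisVec a b := by
    intro a b
    induction a with
    | nil =>
      obtain ⟨y, hy⟩ := hb b
      exact ⟨y, by rw [hy, basisVec_eq u]; simp⟩
    | cons k a ih =>
      obtain ⟨y, hy⟩ := ih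
      refine ⟨V k y, ?_⟩
      rw [← Le_basisVec, ← hy, ← mul_apply_eq_comp, ← mul_apply_eq_comp, hV]
  refine clm_ext_basisVec fun a b => ?_
  obtain ⟨y, hy⟩ := ha a b
  rw [← hy, ← mul_apply_eq_comp, mul_assoc, hU, mul_one, one_apply_eq_self]

end Wold

/-! ### Points of the core -/

section Core

variable {n m : ℕ} {u : Matrix.unitaryGroup (Fin n × Fin m) ℂ}

theorem core_snd {p : Pt n m} (hp : p ∈ core u) (i k : Fin n) (j : Fin m) :
    ∑ l, u.1 (i, j) (k, l) * p.2 l = if k = i then p.2 j else 0 := by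
  have h := congrFun (hp.2 i j).1 k
  simp only [cMat, Matrix.sub_mulVec, Pi.sub_apply, Pi.zero_apply, sub_eq_zero] at h
  simp only [Matrix.mulVec, dotProduct, Matrix.of_apply] at h
  rw [h]
  simp [Matrix.single_apply, ite_and, eq_comm]

theorem core_fst {p : Pt n m} (hp : p ∈ core u) (i : Fin n) (j l : Fin m) :
    ∑ k, u.1 (i, j) (k, l) * p.1 k = if l = j then p.1 i else 0 := by
  have h := congrFun (hp.2 i j).2 l
  simp only [cMat, Matrix.transpose_sub, Matrix.sub_mulVec, Pi.sub_apply, Pi.zero_apply,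
    sub_eq_zero] at h
  simp only [Matrix.mulVec, dotProduct, Matrix.of_apply, Matrix.transpose_apply] at h
  rw [h]
  simp [Matrix.single_apply, ite_and, eq_comm]

/-- Fixed vectors of a unitary are fixed by its adjoint. This turns the core equations into the
conjugated equations on the other index pair. -/
theorem star_mulVec_eq_self {v : Fin n × Fin m → ℂ} (h : u.1.mulVec v = v) :
    (star u.1).mulVec v = v := by
  conv_lhs => rw [← h]
  rw [Matrix.mulVec_mulVec, Matrix.mem_unitaryGroup_iff'.1 u.2, Matrix.one_mulVec]

theorem core_snd_star {p : Pt n m} (hp : p ∈ core u) (i k : Fin n) (l : Fin m) :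
    ∑ j, conj (u.1 (i, j) (k, l)) * p.2 j = if i = k then p.2 l else 0 := by
  have h : u.1.mulVec (fun q => if q.1 = i then p.2 q.2 else 0) =
      fun q => if q.1 = i then p.2 q.2 else 0 := by
    ext ⟨i', j'⟩
    simp only [Matrix.mulVec, dotProduct, Fintype.sum_prod_type, mul_ite, mul_zero]
    rw [Finset.sum_eq_single i]
    · simp [core_snd hp, eq_comm]
    · intro b _ hb; simp [hb]
    · simp
  have h2 := congrFun (star_mulVec_eq_self h) (k, l)
  simp only [Matrix.mulVec, dotProduct, Fintype.sum_prod_type, mul_ite, mul_zero,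
    Matrix.star_apply] at h2
  rw [Finset.sum_eq_single i (by intro b _ hb; simp [hb]) (by simp)] at h2
  simpa [eq_comm] using h2

theorem core_fst_star {p : Pt n m} (hp : p ∈ core u) (j l : Fin m) (k : Fin n) :
    ∑ i, conj (u.1 (i, j) (k, l)) * p.1 i = if j = l then p.1 k else 0 := by
  have h : u.1.mulVec (fun q => if q.2 = j then p.1 q.1 else 0) =
      fun q => if q.2 = j then p.1 q.1 else 0 := by
    ext ⟨i', j'⟩
    simp only [Matrix.mulVec, dotProduct, Fintype.sum_prod_type_right, mul_ite, mul_zero]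
    rw [Finset.sum_eq_single j]
    · simp [core_fst hp, eq_comm]
    · intro b _ hb; simp [hb]
    · simp
  have h2 := congrFun (star_mulVec_eq_self h) (k, l)
  simp only [Matrix.mulVec, dotProduct, Fintype.sum_prod_type_right, mul_ite, mul_zero,
    Matrix.star_apply] at h2
  rw [Finset.sum_eq_single j (by intro b _ hb; simp [hb]) (by simp)] at h2
  simpa [eq_comm] using h2

/-- Contracting the relations for `f_l e_k` with `conj z_k` collapses their coefficients by the
conjugated core equation, leaving only `j = l`. -/
theorem commute_Lf_rowComb {p : Pt n m} (hp : p ∈ core u) (l : Fin m) :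
    Commute (Lf u l) (rowComb Le p.1) := by
  have h : ∀ (i : Fin n) (j : Fin m), ∑ k, conj (p.1 k) * conj (u.1 (i, j) (k, l)) =
      if l = j then conj (p.1 i) else 0 := by
    intro i j
    have := congrArg conj (core_fst hp i j l)
    simp only [map_sum, map_mul, apply_ite conj, map_zero] at this
    rw [← this]
    exact Finset.sum_congr rfl fun k _ => mul_comm _ _
  rw [commute_iff_eq]
  simp only [rowComb, Finset.mul_sum, Finset.sum_mul, mul_smul_comm, smul_mul_assoc, Lf_mul_Le,
    Finset.smul_sum, smul_smul]
  rw [Finset.sum_comm, Fintype.sum_prod_type]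
  simp only [← Finset.sum_smul, h]
  simp

theorem commute_Le_rowComb {p : Pt n m} (hp : p ∈ core u) (k : Fin n) :
    Commute (Le k) (rowComb (Lf u) p.2) := by
  have h : ∀ (i : Fin n) (j : Fin m), ∑ l, conj (p.2 l) * conj (u.1 (i, j) (k, l)) =
      if k = i then conj (p.2 j) else 0 := by
    intro i j
    have := congrArg conj (core_snd hp i k j)
    simp only [map_sum, map_mul, apply_ite conj, map_zero] at this
    rw [← this]
    exact Finset.sum_congr rfl fun k _ => mul_comm _ _
  symm
  rw [commute_iff_eq]
  simp only [rowComb, Finset.mul_sum, Finset.sum_mul, mul_smul_comm, smul_mul_assoc, Lf_mul_Le,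
    Finset.smul_sum, smul_smul]
  rw [Finset.sum_comm, Fintype.sum_prod_type_right]
  simp only [← Finset.sum_smul, h]
  simp

end Core

/-! ### Commutants and closed algebras under Möbius transforms -/

section Commute

variable {A : Type*} [CStarAlgebra A] {ι : Type*} [Fintype ι] {L : ι → A}

theorem commute_rowComb {T : A} (h : ∀ k, Commute T (L k)) (z : EuclideanSpace ℂ ι) :
    Commute T (rowComb L z) :=
  Commute.sum_right _ _ _ fun k _ => (h k).smul_right _

theorem commute_moebius {T : A} (h : ∀ k, Commute T (L k)) (z : EuclideanSpace ℂ ι) (k : ι) :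
    Commute T (moebius L z k) := by
  have h1 : ∀ c : ℂ, Commute T (c • 1) := fun c => (Commute.one_right T).smul_right c
  exact (h1 _).neg_right.add_right
    (((commute_resolv (commute_rowComb h z)).mul_right ((h k).sub_right (h1 _))).smul_right _)

variable [DecidableEq ι]

/-- The Neumann series converges in norm, so the resolvent stays in any closed subalgebra containing
the `L_k`. -/
theorem resolv_mem (hL : IsRowIsometry L) {z : EuclideanSpace ℂ ι} (hz : ‖z‖ < 1)
    {S : Subalgebra ℂ A} (hS : IsClosed (S : Set A)) (h : ∀ k, L k ∈ S) : resolv L z ∈ S := by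
  have hW : rowComb L z ∈ S := S.sum_mem fun k _ => S.smul_mem (h k) _
  have hs := hasSum_geom_series_inverse (rowComb L z) ((norm_rowComb_le hL z).trans_lt hz)
  exact hS.mem_of_tendsto hs (Filter.Eventually.of_forall fun s =>
    S.sum_mem fun k _ => S.pow_mem hW k)

theorem moebius_mem (hL : IsRowIsometry L) {z : EuclideanSpace ℂ ι} (hz : ‖z‖ < 1)
    {S : Subalgebra ℂ A} (hS : IsClosed (S : Set A)) (h : ∀ k, L k ∈ S) (k : ι) :
    moebius L z k ∈ S :=
  S.add_mem (S.neg_mem (S.smul_mem S.one_mem _))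
    (S.smul_mem (S.mul_mem (resolv_mem hL hz hS h)
      (S.sub_mem (h k) (S.smul_mem S.one_mem _))) _)

end Commute

/-! ### Closed invariant subspaces and joint kernels -/

section Invariant

variable {H : Type*} [NormedAddCommGroup H] [InnerProductSpace ℂ H]

/-- The algebra of operators that leave a subspace invariant. -/
def invAlg (K : Submodule ℂ H) : Subalgebra ℂ (H →L[ℂ] H) where
  carrier := {T | ∀ x ∈ K, T x ∈ K}
  mul_mem' hS hT x hx := hS _ (hT x hx)
  add_mem' hS hT x hx := K.add_mem (hS x hx) (hT x hx)
  algebraMap_mem' c x hx := by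
    rw [Algebra.algebraMap_eq_smul_one]
    exact K.smul_mem c hx

theorem isClosed_invAlg {K : Submodule ℂ H} (hK : IsClosed (K : Set H)) :
    IsClosed (invAlg K : Set (H →L[ℂ] H)) := by
  have : (invAlg K : Set (H →L[ℂ] H)) = ⋂ x ∈ K, (fun T : H →L[ℂ] H => T x) ⁻¹' K := by
    ext T
    simp only [Set.mem_iInter, Set.mem_preimage, SetLike.mem_coe]
    rfl
  rw [this]
  exact isClosed_biInter fun x _ => hK.preimage (by fun_prop)

variable [CompleteSpace H] {ι : Type*}

/-- The joint kernel of the adjoints of a family of operators. -/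
def kerStar (L : ι → H →L[ℂ] H) : Submodule ℂ H where
  carrier := {x | ∀ i, star (L i) x = 0}
  add_mem' hx hy i := by rw [map_add, hx i, hy i, add_zero]
  zero_mem' i := map_zero _
  smul_mem' c x hx i := by rw [map_smul, hx i, smul_zero]

theorem isClosed_kerStar (L : ι → H →L[ℂ] H) : IsClosed (kerStar L : Set H) := by
  have : (kerStar L : Set H) = ⋂ i, (fun x => star (L i) x) ⁻¹' {0} := by
    ext x; simp [kerStar]
  rw [this]
  exact isClosed_iInter fun i => isClosed_singleton.preimage (by fun_prop)

end Invariant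

/-! ### Invariance of the `e` part and of the joint kernel of the `L_{e_i}*` -/

section ESpace

variable {n m : ℕ}

/-- The closed span of the vectors `e_a`. -/
def eSpace (n m : ℕ) : Submodule ℂ (Fock n m) where
  carrier := {x | ∀ a b, b ≠ [] → x (a, b) = 0}
  add_mem' {x y} hx hy a b hb := by
    change x (a, b) + y (a, b) = 0
    rw [hx a b hb, hy a b hb, add_zero]
  zero_mem' a b _ := rfl
  smul_mem' c x hx a b hb := by
    change c • x (a, b) = 0
    rw [hx a b hb, smul_zero]

theorem isClosed_eSpace : IsClosed (eSpace n m : Set (Fock n m)) := by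
  have : (eSpace n m : Set (Fock n m)) =
      ⋂ (a) (b) (_ : b ≠ []), (fun x => inner ℂ (basisVec a b) x) ⁻¹' {0} := by
    ext x
    simp only [Set.mem_iInter, Set.mem_preimage, SetLike.mem_coe, inner_basisVec,
      Set.mem_singleton_iff]
    rfl
  rw [this]
  refine isClosed_iInter fun a => isClosed_iInter fun b => isClosed_iInter fun _ =>
    isClosed_singleton.preimage (by fun_prop)

theorem Le_mem_invAlg_eSpace (k : Fin n) : Le k ∈ invAlg (eSpace n m) := by
  intro x hx a b hb
  cases a with
  | nil => exact Le_apply_nil k x b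
  | cons j a => rw [Le_apply_cons, hx a b hb, ite_self]

theorem vac_mem_eSpace : vac n m ∈ eSpace n m := by
  intro a b hb
  rw [← inner_basisVec, vac, inner_basisVec_basisVec]
  simp [hb]

theorem eSpace_le_kerStar (u : Matrix.unitaryGroup (Fin n × Fin m) ℂ) :
    eSpace n m ≤ kerStar (Lf u) := fun _ hx l => star_Lf_eq_zero u hx l

theorem Lf_mem_invAlg_kerStar (u : Matrix.unitaryGroup (Fin n × Fin m) ℂ) (l : Fin m) :
    Lf u l ∈ invAlg (kerStar (Le : Fin n → Fock n m →L[ℂ] Fock n m)) :=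
  fun _ hx i => star_Le_Lf_eq_zero u l hx i

theorem vac_mem_kerStar : vac n m ∈ kerStar (Le : Fin n → Fock n m →L[ℂ] Fock n m) :=
  fun i => star_Le_vac i

end ESpace

/-! ### The unitary attached to a core point -/

section CoreUnitary

variable {n m : ℕ} {u : Matrix.unitaryGroup (Fin n × Fin m) ℂ} {p : Pt n m}

theorem sum_halfPt_smul_Lf (hp : p ∈ core u) (l : Fin m) (k : Fin n) :
    ∑ q : Fin n × Fin m, conj (u.1 q (k, l)) • (halfPt p.1 q.1 • Lf u q.2) =
      halfPt p.1 k • Lf u l := by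
  have h : ∀ j, ∑ i, conj (u.1 (i, j) (k, l)) * halfPt p.1 i =
      if j = l then halfPt p.1 k else 0 := by
    intro j
    simp only [halfPt, ← mul_div_assoc, ← Finset.sum_div, core_fst_star hp]
    split_ifs <;> simp
  rw [Fintype.sum_prod_type_right]
  simp only [smul_smul, ← Finset.sum_smul, h]
  simp

theorem sum_halfPt_smul {V : Fin n → Fock n m →L[ℂ] Fock n m} (hp : p ∈ core u) (l : Fin m)
    (k : Fin n) :
    ∑ q : Fin n × Fin m, conj (u.1 q (k, l)) • (halfPt p.2 q.2 • V q.1) =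
      halfPt p.2 l • V k := by
  have h : ∀ i, ∑ j, conj (u.1 (i, j) (k, l)) * halfPt p.2 j =
      if i = k then halfPt p.2 l else 0 := by
    intro j
    simp only [halfPt, ← mul_div_assoc, ← Finset.sum_div, core_snd_star hp]
    split_ifs <;> simp
  rw [Fintype.sum_prod_type]
  simp only [smul_smul, ← Finset.sum_smul, h]
  simp

/-- The resolvent commutes with `L_{f_l}`, the linear term obeys the relation of the shifts, and the
constants `halfPt p.1` obey it by the core equations. -/
theorem Lf_mul_moebius (hp : p ∈ core u) (l : Fin m) (k : Fin n) :
    Lf u l * moebius Le p.1 k =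
      ∑ q : Fin n × Fin m, conj (u.1 q (k, l)) • (moebius Le p.1 q.1 * Lf u q.2) := by
  have hD : Commute (Lf u l) (resolv Le p.1) := commute_resolv (commute_Lf_rowComb hp l)
  have h1 := sum_halfPt_smul_Lf hp l k
  have h2 := Lf_mul_Le u l k
  have e1 : ∀ q : Fin n × Fin m, conj (u.1 q (k, l)) • (moebius Le p.1 q.1 * Lf u q.2) =
      -(conj (u.1 q (k, l)) • (halfPt p.1 q.1 • Lf u q.2)) +
      defect p.1 • (resolv Le p.1 * (conj (u.1 q (k, l)) • (Le q.1 * Lf u q.2) -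
        conj (u.1 q (k, l)) • (halfPt p.1 q.1 • Lf u q.2))) := by
    intro q
    simp only [moebius, add_mul, neg_mul, smul_mul_assoc, one_mul, mul_assoc, sub_mul, mul_sub,
      mul_smul_comm]
    module
  simp only [e1, Finset.sum_add_distrib, Finset.sum_neg_distrib, ← Finset.smul_sum,
    ← Finset.mul_sum, Finset.sum_sub_distrib]
  rw [h1, ← h2, moebius, mul_add, mul_smul_comm, ← mul_assoc, hD.eq]
  simp only [mul_neg, mul_smul_comm, mul_one, mul_assoc, mul_sub]

theorem moebius_mul_moebius (hp : p ∈ core u) (l : Fin m) (k : Fin n) :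
    moebius (Lf u) p.2 l * moebius Le p.1 k =
      ∑ q : Fin n × Fin m, conj (u.1 q (k, l)) •
        (moebius Le p.1 q.1 * moebius (Lf u) p.2 q.2) := by
  have hD : ∀ k, Commute (resolv (Lf u) p.2) (moebius Le p.1 k) := commute_moebius
    (fun k => (commute_resolv (commute_Le_rowComb hp k)).symm) p.1
  have h1 := sum_halfPt_smul (V := moebius Le p.1) hp l k
  have h2 := Lf_mul_moebius hp l k
  have e1 : ∀ q : Fin n × Fin m, conj (u.1 q (k, l)) •
        (moebius Le p.1 q.1 * moebius (Lf u) p.2 q.2) =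
      -(conj (u.1 q (k, l)) • (halfPt p.2 q.2 • moebius Le p.1 q.1)) +
      defect p.2 • (resolv (Lf u) p.2 * (conj (u.1 q (k, l)) • (moebius Le p.1 q.1 * Lf u q.2) -
        conj (u.1 q (k, l)) • (halfPt p.2 q.2 • moebius Le p.1 q.1))) := by
    intro q
    rw [moebius.eq_def (Lf u), mul_add, mul_smul_comm, ← mul_assoc (moebius Le p.1 q.1),
      ← (hD q.1).eq]
    simp only [mul_neg, mul_smul_comm, mul_one, mul_assoc, mul_sub]
    module
  simp only [e1, Finset.sum_add_distrib, Finset.sum_neg_distrib, ← Finset.smul_sum,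
    ← Finset.mul_sum, Finset.sum_sub_distrib]
  rw [h1, ← h2, moebius.eq_def (Lf u)]
  simp only [add_mul, neg_mul, smul_mul_assoc, one_mul, mul_assoc, sub_mul]

/-- The image of the vacuum under the unitary that implements the automorphism of a core point. -/
def coreVec (u : Matrix.unitaryGroup (Fin n × Fin m) ℂ) (p : Pt n m) : Fock n m :=
  defect p.1 • resolv Le p.1 (defect p.2 • resolv (Lf u) p.2 (vac n m))

theorem isWandering_moebius (hp : p ∈ core u) (h1 : ‖p.1‖ < 1) (h2 : ‖p.2‖ < 1) :
    IsWandering u (moebius Le p.1) (moebius (Lf u) p.2) (coreVec u p) := by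
  have hLe := isRowIsometry_Le (n := n) (m := m)
  have hLf := isRowIsometry_Lf u
  have hw : resolv (Lf u) p.2 (vac n m) ∈ kerStar (Le : Fin n → Fock n m →L[ℂ] Fock n m) :=
    resolv_mem hLf h2 (isClosed_invAlg (isClosed_kerStar _)) (Lf_mem_invAlg_kerStar u) _
      vac_mem_kerStar
  have hz : resolv Le p.1 (vac n m) ∈ kerStar (Lf u) := eSpace_le_kerStar u
    (resolv_mem hLe h1 (isClosed_invAlg isClosed_eSpace) Le_mem_invAlg_eSpace _ vac_mem_eSpace)
  have hvF : vac n m ∈ kerStar (Lf u) := eSpace_le_kerStar u vac_mem_eSpace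
  have hcf : ∀ l, Commute (Lf u l) (resolv Le p.1) := fun l =>
    commute_resolv (commute_Lf_rowComb hp l)
  have hDD : Commute (resolv Le p.1) (resolv (Lf u) p.2) :=
    commute_resolv (commute_rowComb (fun l => (hcf l).symm) p.2)
  refine ⟨isRowIsometry_moebius hLe h1, isRowIsometry_moebius hLf h2, moebius_mul_moebius hp,
    ?_, ?_, ?_⟩
  · have : inner ℂ (coreVec u p) (coreVec u p) = 1 := by
      rw [coreVec, inner_resolv_resolv hLe h1 (Submodule.smul_mem _ _ hw)
        (Submodule.smul_mem _ _ hw), inner_resolv_resolv hLf h2 hvF hvF,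
        inner_self_eq_norm_sq_to_K, norm_vac]
      simp
    rw [inner_self_eq_norm_sq_to_K] at this
    have h3 : ‖coreVec u p‖ ^ 2 = 1 := Complex.ofReal_injective (by simpa using this)
    exact (pow_eq_one_iff_of_nonneg (norm_nonneg _) two_ne_zero).1 h3
  -- The two resolvents commute, so the one for `f` can be moved outside, where it acts on a vector
  -- of the joint kernel of the `L_{f_l}*`.
  · intro l
    rw [coreVec, map_smul, map_smul, ← mul_apply_eq_comp (resolv Le p.1), hDD.eq,
      mul_apply_eq_comp, map_smul, star_moebius_resolv_apply hLf h2 hz, smul_zero, smul_zero]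
  -- A word in the transformed `f` shifts commutes with the resolvent for `e` and preserves the
  -- joint kernel of the `L_{e_k}*`.
  · intro k b
    have hY : ∀ l, Commute (moebius (Lf u) p.2 l) (resolv Le p.1) := fun l =>
      (commute_moebius (fun l => (hcf l).symm) p.2 l).symm
    have hb : Commute (b.map (moebius (Lf u) p.2)).prod (resolv Le p.1) := by
      induction b with
      | nil => exact Commute.one_left _
      | cons l b ih => rw [List.map_cons, List.prod_cons]; exact (hY l).mul_left ih
    have hK : (b.map (moebius (Lf u) p.2)).prod ∈
        invAlg (kerStar (Le : Fin n → Fock n m →L[ℂ] Fock n m)) :=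
      Subalgebra.list_prod_mem _ fun T hT => by
        obtain ⟨l, _, rfl⟩ := List.mem_map.1 hT
        exact moebius_mem hLf h2 (isClosed_invAlg (isClosed_kerStar _))
          (Lf_mem_invAlg_kerStar u) l
    rw [coreVec, map_smul, map_smul, ← mul_apply_eq_comp (b.map (moebius (Lf u) p.2)).prod,
      hb.eq, mul_apply_eq_comp,
      star_moebius_resolv_apply hLe h1 (hK _ (Submodule.smul_mem _ _ hw)), smul_zero]

/-- The unitary implementing the automorphism attached to a core point. -/
theorem exists_core_unitary (hp : p ∈ core u) (h1 : ‖p.1‖ < 1) (h2 : ‖p.2‖ < 1) :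
    ∃ U ∈ unitary (Fock n m →L[ℂ] Fock n m),
      (∀ k, U * Le k * star U = moebius Le p.1 k) ∧
      (∀ l, U * Lf u l * star U = moebius (Lf u) p.2 l) ∧
      (∀ k, star U * Le k * U = moebius Le (-p.1) k) ∧
      (∀ l, star U * Lf u l * U = moebius (Lf u) (-p.2) l) := by
  have hLe := isRowIsometry_Le (n := n) (m := m)
  have hLf := isRowIsometry_Lf u
  obtain ⟨U, hU, hE, hF, hv⟩ := (isWandering_moebius hp h1 h2).exists_intertwiner
  have hE' := intertwine_neg hLe h1 hE
  have hF' := intertwine_neg hLf h2 hF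
  have rE := intertwine_resolv hLe h1 hE
  have rF := intertwine_resolv hLf h2 hF
  -- The preimage of the vacuum is the analogous vector for `-p`. It is found by stripping the two
  -- resolvents from `U vac = coreVec u p` with `intertwine_resolv`, which produces resolvents at
  -- `-p` inside `U`.
  have hx : U ((defect p.1 * defect p.2) • resolv (Lf u) (-p.2) (resolv Le (-p.1) (vac n m))) =
      vac n m := by
    have d1 := defect_ne_zero h1
    have d2 := defect_ne_zero h2
    have e1 : (1 - rowComb Le p.1) (U (vac n m)) =
        (defect p.1 * defect p.2) • resolv (Lf u) p.2 (vac n m) := by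
      rw [hv, coreVec, map_smul, ← mul_apply_eq_comp, mul_resolv hLe h1, one_apply_eq_self,
        smul_smul]
    rw [← mul_apply_eq_comp, rE] at e1
    have e2 := congrArg (⇑(1 - rowComb (Lf u) p.2)) e1
    rw [map_smul, ← mul_apply_eq_comp _ (resolv (Lf u) p.2), mul_resolv hLf h2, smul_apply,
      map_smul, mul_apply_eq_comp, ← mul_apply_eq_comp (1 - rowComb (Lf u) p.2), rF, smul_apply,
      mul_apply_eq_comp, smul_smul, one_apply_eq_self] at e2
    rw [map_smul]
    refine smul_right_injective _ (mul_ne_zero d1 d2) ?_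
    simp only
    rw [← e2, smul_smul]
    congr 1; ring
  have hU' := mul_star_eq_one_of_invariant hU hE' hF' hx
  refine ⟨U, Unitary.mem_iff.2 ⟨hU, hU'⟩, fun k => ?_, fun l => ?_, fun k => ?_, fun l => ?_⟩
  · rw [hE, mul_assoc, hU', mul_one]
  · rw [hF, mul_assoc, hU', mul_one]
  · rw [mul_assoc, hE', ← mul_assoc, hU, one_mul]
  · rw [mul_assoc, hF', ← mul_assoc, hU, one_mul]

end CoreUnitary

/-! ### The weak-* topology and unitary conjugation -/

section WeakStar

variable {H : Type*} [NormedAddCommGroup H] [InnerProductSpace ℂ H]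

/-- Each functional defining the weak-* topology is norm bounded, by the product of the norms of its
two sequences. -/
theorem norm_topology_le_weakStar :
    (inferInstance : TopologicalSpace (H →L[ℂ] H)) ≤ weakStar H := by
  refine continuous_iff_le_induced.1 (continuous_pi fun p => ?_)
  let F : (H →L[ℂ] H) →ₗ[ℂ] ℂ :=
    { toFun := fun T => inner ℂ p.2 (seqMap T p.1)
      map_add' := fun S T => by
        rw [← inner_add_right]; congr 1
      map_smul' := fun c T => by
        rw [RingHom.id_apply, smul_eq_mul, ← inner_smul_right]; congr 1 }
  have hF : ∀ T, ‖F T‖ ≤ (‖p.2‖ * ‖p.1‖) * ‖T‖ := by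
    intro T
    have h1 : ‖seqMap T p.1‖ ≤ ‖T‖ * ‖p.1‖ :=
      ContinuousLinearMap.le_of_opNorm_le _ (lp.norm_mapCLM_le _ _ _ _) _
    calc ‖F T‖ ≤ ‖p.2‖ * ‖seqMap T p.1‖ := norm_inner_le_norm (𝕜 := ℂ) p.2 (seqMap T p.1)
      _ ≤ ‖p.2‖ * (‖T‖ * ‖p.1‖) := by gcongr
      _ = _ := by ring
  have hc : Continuous F := (F.mkContinuous _ hF).continuous
  refine hc.congr fun T => ?_
  exact lp.inner_eq_tsum _ _

theorem continuous_weakStar_inner (x y : H) :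
    @Continuous _ _ (weakStar H) _ (fun T : H →L[ℂ] H => inner ℂ y (T x)) := by
  let _ := weakStar H
  have h := continuous_weakStar_eval (lp.single 2 0 x : ℓ²(ℕ, H)) (lp.single 2 0 y)
  refine h.congr fun T => ?_
  rw [tsum_eq_single 0]
  · simp
  · intro k hk
    rw [lp.single_apply_ne _ _ _ hk, inner_zero_left]

variable [CompleteSpace H]

theorem continuous_weakStar_mul_mul (S R : H →L[ℂ] H) :
    @Continuous _ _ (weakStar H) (weakStar H) (fun T : H →L[ℂ] H => S * T * R) := by
  let _ := weakStar H
  have := isSemitopologicalSemiring_weakStar (H := H)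
  exact (continuous_mul_const R).comp (continuous_const_mul S)

theorem isClosed_weakStarClosure (A : Subalgebra ℂ (H →L[ℂ] H)) :
    @IsClosed _ (weakStar H) (weakStarClosure A : Set (H →L[ℂ] H)) :=
  @Subalgebra.isClosed_topologicalClosure ℂ _ (H →L[ℂ] H) (weakStar H) _ _
    isSemitopologicalSemiring_weakStar A

theorem weakStarClosure_le {A B : Subalgebra ℂ (H →L[ℂ] H)} (h : A ≤ B)
    (hB : @IsClosed _ (weakStar H) (B : Set (H →L[ℂ] H))) : weakStarClosure A ≤ B :=
  @Subalgebra.topologicalClosure_minimal ℂ _ (H →L[ℂ] H) (weakStar H) _ _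
    isSemitopologicalSemiring_weakStar A B h hB

/-- Conjugation by a unitary, as an automorphism of `B(H)`. -/
def conjAut {U : H →L[ℂ] H} (hU : U ∈ unitary (H →L[ℂ] H)) : (H →L[ℂ] H) ≃ₐ[ℂ] (H →L[ℂ] H) :=
  (Unitary.conjStarAlgAut ℂ (H →L[ℂ] H) ⟨U, hU⟩).toAlgEquiv

theorem conjAut_apply {U : H →L[ℂ] H} (hU : U ∈ unitary (H →L[ℂ] H)) (T : H →L[ℂ] H) :
    conjAut hU T = U * T * star U := rfl

theorem conjAut_symm_apply {U : H →L[ℂ] H} (hU : U ∈ unitary (H →L[ℂ] H)) (T : H →L[ℂ] H) :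
    (conjAut hU).symm T = star U * T * U := rfl

/-- Applying `U` in each summand is a unitary of the direct sum, and it conjugates one operator
matrix into the other. -/
theorem norm_matrixOp_conj {k : ℕ} {U : H →L[ℂ] H} (hU : U ∈ unitary (H →L[ℂ] H))
    (M : Matrix (Fin k) (Fin k) (H →L[ℂ] H)) :
    ‖matrixOp (M.map (conjAut hU))‖ = ‖matrixOp M‖ := by
  let e : H ≃ₗᵢ[ℂ] H := Unitary.linearIsometryEquiv ⟨U, hU⟩
  let E := LinearIsometryEquiv.piLpCongrRight 2 (fun _ : Fin k => e)
  have h : matrixOp (M.map (conjAut hU)) =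
      E.toLinearIsometry.toContinuousLinearMap ∘L
        (matrixOp M ∘L
          (E.symm : PiLp 2 (fun _ : Fin k => H) →L[ℂ] PiLp 2 (fun _ : Fin k => H))) := by
    ext x i
    simp [matrixOp, E, e, sum_apply, conjAut_apply]
    rfl
  rw [h, LinearIsometry.norm_toContinuousLinearMap_comp,
    ContinuousLinearMap.opNorm_comp_linearIsometryEquiv]

end WeakStar

/-- An automorphism of an algebra that leaves a subalgebra invariant, together with its inverse,
restricts to the subalgebra. -/
def restrictAut {A : Type*} [Ring A] [Algebra ℂ A] (Φ : A ≃ₐ[ℂ] A) (S : Subalgebra ℂ A)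
    (h : ∀ x ∈ S, Φ x ∈ S) (h' : ∀ x ∈ S, Φ.symm x ∈ S) : S ≃ₐ[ℂ] S :=
  AlgEquiv.ofAlgHom ((Φ.toAlgHom.comp S.val).codRestrict S fun x => h x x.2)
    ((Φ.symm.toAlgHom.comp S.val).codRestrict S fun x => h' x x.2)
    (AlgHom.ext fun x => Subtype.ext (Φ.apply_symm_apply x))
    (AlgHom.ext fun x => Subtype.ext (Φ.symm_apply_apply x))

theorem restrictAut_apply {A : Type*} [Ring A] [Algebra ℂ A] (Φ : A ≃ₐ[ℂ] A)
    (S : Subalgebra ℂ A) (h : ∀ x ∈ S, Φ x ∈ S) (h' : ∀ x ∈ S, Φ.symm x ∈ S) (x : S) :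
    (restrictAut Φ S h h' x : A) = Φ x := rfl

theorem restrictAut_symm_apply {A : Type*} [Ring A] [Algebra ℂ A] (Φ : A ≃ₐ[ℂ] A)
    (S : Subalgebra ℂ A) (h : ∀ x ∈ S, Φ x ∈ S) (h' : ∀ x ∈ S, Φ.symm x ∈ S) (x : S) :
    ((restrictAut Φ S h h').symm x : A) = Φ.symm x := rfl

/-! ### The vacuum character -/

section Vacuum

variable {n m : ℕ}

/-- The operators for whose adjoint the vacuum is an eigenvector. -/
def vacAlg (n m : ℕ) : Subalgebra ℂ (Fock n m →L[ℂ] Fock n m) where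
  carrier := {T | ∀ y, inner ℂ (vac n m) (T y) =
    inner ℂ (vac n m) (T (vac n m)) * inner ℂ (vac n m) y}
  mul_mem' {S T} hS hT y := by
    rw [mul_apply_eq_comp, mul_apply_eq_comp, hS (T y), hT y, hS (T (vac n m))]
    ring
  add_mem' {S T} hS hT y := by
    simp only [add_apply, inner_add_right, hS y, hT y]
    ring
  algebraMap_mem' c y := by
    rw [Algebra.algebraMap_eq_smul_one]
    simp only [smul_apply, one_apply_eq_self, inner_smul_right, inner_self_eq_norm_sq_to_K,
      norm_vac]
    simp

theorem inner_vac_vac : inner ℂ (vac n m) (vac n m) = 1 := by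
  rw [inner_self_eq_norm_sq_to_K, norm_vac]; simp

/-- The vector state of the vacuum, which is multiplicative. -/
def vacChar (n m : ℕ) : vacAlg n m →ₐ[ℂ] ℂ where
  toFun T := inner ℂ (vac n m) ((T : Fock n m →L[ℂ] Fock n m) (vac n m))
  map_one' := inner_vac_vac
  map_mul' S T := S.2 _
  map_zero' := inner_zero_right _
  map_add' S T := inner_add_right _ _ _
  commutes' c := by
    change inner ℂ (vac n m) (algebraMap ℂ (Fock n m →L[ℂ] Fock n m) c (vac n m)) = c
    rw [Algebra.algebraMap_eq_smul_one, smul_apply, one_apply_eq_self, inner_smul_right,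
      inner_vac_vac, mul_one]

theorem inner_vac_Le (i : Fin n) (y : Fock n m) : inner ℂ (vac n m) (Le i y) = 0 := by
  rw [← ContinuousLinearMap.adjoint_inner_left, ← ContinuousLinearMap.star_eq_adjoint,
    star_Le_vac, inner_zero_left]

theorem inner_vac_Lf (u : Matrix.unitaryGroup (Fin n × Fin m) ℂ) (j : Fin m) (y : Fock n m) :
    inner ℂ (vac n m) (Lf u j y) = 0 := by
  rw [← ContinuousLinearMap.adjoint_inner_left, ← ContinuousLinearMap.star_eq_adjoint,
    star_Lf_vac, inner_zero_left]

theorem Le_mem_vacAlg (i : Fin n) : Le i ∈ vacAlg n m := fun y => by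
  rw [inner_vac_Le, inner_vac_Le, zero_mul]

theorem Lf_mem_vacAlg (u : Matrix.unitaryGroup (Fin n × Fin m) ℂ) (j : Fin m) :
    Lf u j ∈ vacAlg n m := fun y => by
  rw [inner_vac_Lf, inner_vac_Lf, zero_mul]

/-- A subalgebra that contains the shifts contains the polynomial algebra. -/
theorem polyAlg_le {u : Matrix.unitaryGroup (Fin n × Fin m) ℂ}
    {S : Subalgebra ℂ (Fock n m →L[ℂ] Fock n m)} (hE : ∀ i, Le i ∈ S) (hF : ∀ j, Lf u j ∈ S) :
    polyAlg u ≤ S :=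
  Algebra.adjoin_le (Set.union_subset (Set.range_subset_iff.2 hE) (Set.range_subset_iff.2 hF))

theorem isClosed_vacAlg :
    @IsClosed _ (weakStar (Fock n m)) (vacAlg n m : Set (Fock n m →L[ℂ] Fock n m)) := by
  let _ := weakStar (Fock n m)
  have : (vacAlg n m : Set (Fock n m →L[ℂ] Fock n m)) = ⋂ y, {T | inner ℂ (vac n m) (T y) =
      inner ℂ (vac n m) (T (vac n m)) * inner ℂ (vac n m) y} := by
    ext T
    simp only [Set.mem_iInter, Set.mem_ofPred_eq, SetLike.mem_coe]
    rfl
  rw [this]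
  exact isClosed_iInter fun y => isClosed_eq (continuous_weakStar_inner _ _)
    ((continuous_weakStar_inner _ _).mul continuous_const)

variable (u : Matrix.unitaryGroup (Fin n × Fin m) ℂ)

theorem isClosed_wstarAlg : @IsClosed _ (weakStar (Fock n m))
    (wstarAlg u : Set (Fock n m →L[ℂ] Fock n m)) := isClosed_weakStarClosure _

theorem isClosed_normAlg : IsClosed (normAlg u : Set (Fock n m →L[ℂ] Fock n m)) :=
  Subalgebra.isClosed_topologicalClosure _

theorem normAlg_le_wstarAlg : normAlg u ≤ wstarAlg u :=
  Subalgebra.topologicalClosure_minimal (polyAlg_le_wstarAlg u)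
    (IsClosed.mono (isClosed_wstarAlg u) norm_topology_le_weakStar)

theorem wstarAlg_le_vacAlg : wstarAlg u ≤ vacAlg n m :=
  weakStarClosure_le (polyAlg_le Le_mem_vacAlg (Lf_mem_vacAlg u)) isClosed_vacAlg

/-- The vacuum character of `ℒᵤ`. -/
def wstarVacChar : wstarAlg u →ₐ[ℂ] ℂ :=
  (vacChar n m).comp (Subalgebra.inclusion (wstarAlg_le_vacAlg u))

theorem wstarVacChar_apply (T : wstarAlg u) :
    wstarVacChar u T = inner ℂ (vac n m) ((T : Fock n m →L[ℂ] Fock n m) (vac n m)) := rfl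

theorem continuous_wstarVacChar :
    @Continuous _ _ (weakStarOn (wstarAlg u)) _ (wstarVacChar u) := by
  let _ := weakStar (Fock n m)
  exact (continuous_weakStar_inner (vac n m) (vac n m)).comp continuous_subtype_val

variable {u}

/-- The adjoint of the resolvent fixes the vacuum and `L_k` has zero vacuum expectation, so only the
constants `c + s c = z` remain, with `c = halfPt z k`. -/
theorem vacChar_moebius {ι : Type*} [Fintype ι] [DecidableEq ι]
    {L : ι → Fock n m →L[ℂ] Fock n m} (hL : IsRowIsometry L)
    (hv : ∀ k, star (L k) (vac n m) = 0) {z : EuclideanSpace ℂ ι} (hz : ‖z‖ < 1) (k : ι) :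
    inner ℂ (vac n m) (moebius L (-z) k (vac n m)) = z k := by
  have hz' : ‖-z‖ < 1 := by rwa [norm_neg]
  have h1 : ∀ y, inner ℂ (vac n m) (resolv L (-z) y) = inner ℂ (vac n m) y := by
    intro y
    rw [← ContinuousLinearMap.adjoint_inner_left, ← ContinuousLinearMap.star_eq_adjoint,
      star_resolv_apply hL hz' hv]
  have h2 : inner ℂ (vac n m) (L k (vac n m)) = 0 := by
    rw [← ContinuousLinearMap.adjoint_inner_left, ← ContinuousLinearMap.star_eq_adjoint, hv,
      inner_zero_left]
  rw [eq_mul_halfPt z k, moebius, halfPt_neg, defect_neg]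
  simp only [add_apply, neg_apply, smul_apply, one_apply_eq_self, mul_apply_eq_comp, sub_apply,
    inner_add_right, inner_neg_right, inner_smul_right, inner_sub_right, h1, h2, inner_vac_vac]
  ring

end Vacuum

/-! ### Automorphisms attached to points of the core -/

section CoreAut

variable {n m : ℕ} {u : Matrix.unitaryGroup (Fin n × Fin m) ℂ} {p : Pt n m}

theorem normAlg_conj_mem {U : Fock n m →L[ℂ] Fock n m}
    (hE : ∀ k, U * Le k * star U ∈ normAlg u) (hF : ∀ l, U * Lf u l * star U ∈ normAlg u)
    (hU : U ∈ unitary (Fock n m →L[ℂ] Fock n m)) {T : Fock n m →L[ℂ] Fock n m}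
    (hT : T ∈ normAlg u) : U * T * star U ∈ normAlg u := by
  have h : normAlg u ≤ (normAlg u).comap (conjAut hU).toAlgHom :=
    Subalgebra.topologicalClosure_minimal (polyAlg_le hE hF)
      ((isClosed_normAlg u).preimage
        (by fun_prop : Continuous fun T : Fock n m →L[ℂ] Fock n m => U * T * star U))
  exact h hT

theorem wstarAlg_conj_mem {U : Fock n m →L[ℂ] Fock n m}
    (hE : ∀ k, U * Le k * star U ∈ normAlg u) (hF : ∀ l, U * Lf u l * star U ∈ normAlg u)
    (hU : U ∈ unitary (Fock n m →L[ℂ] Fock n m)) {T : Fock n m →L[ℂ] Fock n m}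
    (hT : T ∈ wstarAlg u) : U * T * star U ∈ wstarAlg u := by
  have h : wstarAlg u ≤ (wstarAlg u).comap (conjAut hU).toAlgHom :=
    weakStarClosure_le (polyAlg_le (fun k => normAlg_le_wstarAlg u (hE k))
      fun l => normAlg_le_wstarAlg u (hF l))
      (@IsClosed.preimage _ _ (weakStar _) (weakStar _) _
        (continuous_weakStar_mul_mul U (star U)) _ (isClosed_wstarAlg u))
  exact h hT

/-- The automorphism is conjugation by the unitary of the core point. Since the action on characters
uses the inverse automorphism, the transform that appears is the one at `-p`, whose vacuum
expectation is `p`. -/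
theorem exists_wstar_aut (hp : p ∈ core u) (hb : p ∈ openBalls n m) :
    ∃ Ψ : wstarAlg u ≃ₐ[ℂ] wstarAlg u,
      CompletelyIsometric Ψ ∧ IsWStarHomeo u Ψ ∧ RestrictsToNormAlg u Ψ ∧ WStarMoves u Ψ 0 p := by
  have h1 : ‖p.1‖ < 1 := mem_ball_zero_iff.1 hb.1
  have h2 : ‖p.2‖ < 1 := mem_ball_zero_iff.1 hb.2
  have h1' : ‖-p.1‖ < 1 := by rwa [norm_neg]
  have h2' : ‖-p.2‖ < 1 := by rwa [norm_neg]
  obtain ⟨U, hU, hE, hF, hE', hF'⟩ := exists_core_unitary hp h1 h2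
  have mE : ∀ k, Le k ∈ normAlg u := fun k => polyAlg_le_normAlg u (Le_mem u k)
  have mF : ∀ l, Lf u l ∈ normAlg u := fun l => polyAlg_le_normAlg u (Lf_mem u l)
  have hc := isClosed_normAlg u
  have kE : ∀ k, U * Le k * star U ∈ normAlg u := fun k => by
    rw [hE]; exact moebius_mem isRowIsometry_Le h1 hc mE k
  have kF : ∀ l, U * Lf u l * star U ∈ normAlg u := fun l => by
    rw [hF]; exact moebius_mem (isRowIsometry_Lf u) h2 hc mF l
  have kE' : ∀ k, star U * Le k * star (star U) ∈ normAlg u := fun k => by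
    rw [star_star, hE']; exact moebius_mem isRowIsometry_Le h1' hc mE k
  have kF' : ∀ l, star U * Lf u l * star (star U) ∈ normAlg u := fun l => by
    rw [star_star, hF']; exact moebius_mem (isRowIsometry_Lf u) h2' hc mF l
  have hU' : star U ∈ unitary (Fock n m →L[ℂ] Fock n m) := Unitary.star_mem hU
  have w1 : ∀ T ∈ wstarAlg u, conjAut hU T ∈ wstarAlg u := fun T hT =>
    wstarAlg_conj_mem kE kF hU hT
  have w2 : ∀ T ∈ wstarAlg u, (conjAut hU).symm T ∈ wstarAlg u := fun T hT => by
    have := wstarAlg_conj_mem kE' kF' hU' hT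
    rwa [star_star] at this
  refine ⟨restrictAut (conjAut hU) (wstarAlg u) w1 w2, ?_, ?_, ?_, ?_⟩
  · intro k M
    exact norm_matrixOp_conj hU (M.map fun a => (a : Fock n m →L[ℂ] Fock n m))
  · let _ := weakStar (Fock n m)
    refine Homeomorph.isHomeomorph
      { toEquiv := (restrictAut (conjAut hU) (wstarAlg u) w1 w2).toEquiv
        continuous_toFun := ?_
        continuous_invFun := ?_ }
    · exact continuous_induced_rng.2
        ((continuous_weakStar_mul_mul U (star U)).comp continuous_subtype_val)
    · exact continuous_induced_rng.2
        ((continuous_weakStar_mul_mul (star U) U).comp continuous_subtype_val)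
  · intro x
    rw [restrictAut_apply]
    refine ⟨fun h => ?_, fun h => normAlg_conj_mem kE kF hU h⟩
    have h3 := normAlg_conj_mem kE' kF' hU' h
    rw [star_star, ← conjAut_symm_apply hU, AlgEquiv.symm_apply_apply] at h3
    exact h3
  · refine ⟨wstarVacChar u, continuous_wstarVacChar u, ?_, ?_⟩
    · refine Prod.ext (PiLp.ext fun k => ?_) (PiLp.ext fun l => ?_)
      · exact (wstarVacChar_apply u _).trans (inner_vac_Le k _)
      · exact (wstarVacChar_apply u _).trans (inner_vac_Lf u l _)
    · refine Prod.ext (PiLp.ext fun k => ?_) (PiLp.ext fun l => ?_)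
      · refine (wstarVacChar_apply u ((restrictAut (conjAut hU) (wstarAlg u) w1 w2).symm
          ⟨Le k, polyAlg_le_wstarAlg u (Le_mem u k)⟩)).trans ?_
        rw [restrictAut_symm_apply, conjAut_symm_apply, hE',
          vacChar_moebius isRowIsometry_Le (fun k => star_Le_vac k) h1]
      · refine (wstarVacChar_apply u ((restrictAut (conjAut hU) (wstarAlg u) w1 w2).symm
          ⟨Lf u l, polyAlg_le_wstarAlg u (Lf_mem u l)⟩)).trans ?_
        rw [restrictAut_symm_apply, conjAut_symm_apply, hF',
          vacChar_moebius (isRowIsometry_Lf u) (star_Lf_vac u) h2]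

/-- An automorphism of `ℒᵤ` that restricts to `𝒜ᵤ` moves the characters of `𝒜ᵤ` in the same
way. -/
theorem exists_norm_aut {q : Pt n m} (Ψ : wstarAlg u ≃ₐ[ℂ] wstarAlg u)
    (hΨ : RestrictsToNormAlg u Ψ) (hm : WStarMoves u Ψ q p) :
    ∃ Ψ' : normAlg u ≃ₐ[ℂ] normAlg u, Moves u Ψ' q p := by
  obtain ⟨φ, -, h0, hq⟩ := hm
  let ι : normAlg u →ₐ[ℂ] wstarAlg u := Subalgebra.inclusion (normAlg_le_wstarAlg u)
  have h1 : ∀ x : normAlg u, (Ψ (ι x) : Fock n m →L[ℂ] Fock n m) ∈ normAlg u := fun x =>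
    (hΨ (ι x)).2 x.2
  have h2 : ∀ x : normAlg u, (Ψ.symm (ι x) : Fock n m →L[ℂ] Fock n m) ∈ normAlg u := fun x => by
    rw [← hΨ, AlgEquiv.apply_symm_apply]; exact x.2
  let F : normAlg u →ₐ[ℂ] normAlg u :=
    ((wstarAlg u).val.comp (Ψ.toAlgHom.comp ι)).codRestrict (normAlg u) h1
  let G : normAlg u →ₐ[ℂ] normAlg u :=
    ((wstarAlg u).val.comp (Ψ.symm.toAlgHom.comp ι)).codRestrict (normAlg u) h2
  have hF : ∀ x, ι (F x) = Ψ (ι x) := fun x => Subtype.ext rfl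
  have hG : ∀ x, ι (G x) = Ψ.symm (ι x) := fun x => Subtype.ext rfl
  have hι : Function.Injective ι := Subalgebra.inclusion_injective _
  refine ⟨AlgEquiv.ofAlgHom F G (AlgHom.ext fun x => hι ?_) (AlgHom.ext fun x => hι ?_),
    φ.comp ι, h0, ?_⟩
  · rw [AlgHom.comp_apply, hF, hG, AlgEquiv.apply_symm_apply]; rfl
  · rw [AlgHom.comp_apply, hG, hF, AlgEquiv.symm_apply_apply]; rfl
  · rw [← hq]
    refine Prod.ext (PiLp.ext fun k => ?_) (PiLp.ext fun l => ?_)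
    · exact congrArg φ (hG _)
    · exact congrArg φ (hG _)

end CoreAut

/-! ### Factorization of elements of the kernel of a character -/

theorem mem_of_mem_adjoin_of_mul_left {A : Type*} [Ring A] [Algebra ℂ A] {s : Set A}
    {M : Submodule ℂ A} (h1 : 1 ∈ M) (h : ∀ g ∈ s, ∀ y ∈ M, g * y ∈ M) {x : A}
    (hx : x ∈ Algebra.adjoin ℂ s) : x ∈ M := by
  rw [← Subalgebra.mem_toSubmodule, Algebra.adjoin_eq_span] at hx
  refine Submodule.span_le.2 (fun y hy => ?_) hx
  induction hy using Submonoid.closure_induction_left with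
  | one => exact h1
  | mul_left g hg y _ ih => exact h g hg y ih

section Division

variable {H : Type*} [NormedAddCommGroup H] [InnerProductSpace ℂ H] {ι : Type*} [Fintype ι]

/-- The elements `r + ∑ (Lᵢ - zᵢ) qᵢ` with `r ∈ S` and `qᵢ ∈ B`. -/
def divSub (L : ι → H →L[ℂ] H) (z : EuclideanSpace ℂ ι) (B S : Submodule ℂ (H →L[ℂ] H)) :
    Submodule ℂ (H →L[ℂ] H) where
  carrier := {p | ∃ r ∈ S, ∃ q : ι → H →L[ℂ] H, (∀ i, q i ∈ B) ∧
    p = r + ∑ i, (L i - z i • 1) * q i}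
  zero_mem' := ⟨0, S.zero_mem, 0, fun _ => B.zero_mem, by simp⟩
  add_mem' := by
    rintro _ _ ⟨r, hr, q, hq, rfl⟩ ⟨r', hr', q', hq', rfl⟩
    refine ⟨r + r', S.add_mem hr hr', q + q', fun i => B.add_mem (hq i) (hq' i), ?_⟩
    simp only [Pi.add_apply, mul_add, Finset.sum_add_distrib]
    abel
  smul_mem' := by
    rintro c _ ⟨r, hr, q, hq, rfl⟩
    refine ⟨c • r, S.smul_mem c hr, c • q, fun i => B.smul_mem c (hq i), ?_⟩
    simp only [Pi.smul_apply, mul_smul_comm, smul_add, Finset.smul_sum]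

theorem mem_divSub_of_mem {L : ι → H →L[ℂ] H} {z : EuclideanSpace ℂ ι}
    {B S : Submodule ℂ (H →L[ℂ] H)} {r : H →L[ℂ] H} (hr : r ∈ S) : r ∈ divSub L z B S :=
  ⟨r, hr, 0, fun _ => B.zero_mem, by simp⟩

variable [DecidableEq ι]

theorem mul_mem_divSub {L : ι → H →L[ℂ] H} {z : EuclideanSpace ℂ ι}
    {B S : Submodule ℂ (H →L[ℂ] H)} {p : H →L[ℂ] H} (hp : p ∈ divSub L z B S) (hB : p ∈ B)
    (i : ι) : L i * p ∈ divSub L z B S := by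
  have h : L i * p = (L i - z i • 1) * p + z i • p := by
    rw [sub_mul, smul_mul_assoc, one_mul]; abel
  rw [h]
  refine Submodule.add_mem _ ⟨0, S.zero_mem, Pi.single i p, fun j => ?_, ?_⟩
    (Submodule.smul_mem _ _ hp)
  · by_cases hj : j = i
    · subst hj; simpa using hB
    · simp [hj]
  · rw [zero_add, Finset.sum_eq_single i]
    · simp
    · intro j _ hj; simp [hj]
    · simp

variable [CompleteSpace H] {L : ι → H →L[ℂ] H} {z : EuclideanSpace ℂ ι}

/-- Since `W* L_i = z_i`, one has `L_i - z_i = (1 - W)* L_i`. Division by the `L_i - z_i` thus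
reduces to division by the `L_i`, whose ranges are orthogonal. -/
theorem star_resolv_mul_div (hL : IsRowIsometry L) (hz : ‖z‖ < 1) (q : ι → H →L[ℂ] H) :
    star (resolv L z) * ∑ i, (L i - z i • 1) * q i = ∑ i, L i * q i := by
  have h1 : ∀ i, L i - z i • 1 = star (1 - rowComb L z) * L i := by
    intro i
    rw [star_sub, star_one, sub_mul, one_mul, star_rowComb_mul hL]
  have h2 := congrArg star (mul_resolv hL hz)
  rw [star_mul, star_one] at h2
  simp only [h1, mul_assoc, ← Finset.mul_sum]
  rw [← mul_assoc, h2, one_mul]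

theorem star_mul_sum_mul (hL : IsRowIsometry L) (q : ι → H →L[ℂ] H) (j : ι) :
    star (L j) * ∑ i, L i * q i = q j := by
  simp [Finset.mul_sum, ← mul_assoc, hL j]

/-- Applying `D*` to `p x` leaves `r x + ∑ L_i q_i x`, an orthogonal sum because `r x` lies in the
joint kernel. The remainder is therefore controlled by the dividend. -/
theorem norm_remainder_apply_le (hL : IsRowIsometry L) (hz : ‖z‖ < 1) {K : Submodule ℂ H}
    (hK : K ≤ kerStar L) {p r : H →L[ℂ] H} {q : ι → H →L[ℂ] H}
    (hp : p = r + ∑ i, (L i - z i • 1) * q i) {x : H} (hx : r x ∈ K) :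
    ‖r x‖ ≤ ‖star (resolv L z)‖ * ‖p‖ * ‖x‖ := by
  have e : star (resolv L z) (p x) = r x + ∑ i, L i (q i x) := by
    have h := congrArg (fun T : H →L[ℂ] H => (star (resolv L z) * T) x) hp
    simp only [mul_add, star_resolv_mul_div hL hz, mul_apply_eq_comp, add_apply, sum_apply,
      star_resolv_apply hL hz (hK hx)] at h
    exact h
  have ho : inner ℂ (r x) (∑ i, L i (q i x)) = 0 := by
    rw [inner_sum]
    refine Finset.sum_eq_zero fun i _ => ?_
    rw [← ContinuousLinearMap.adjoint_inner_left, ← ContinuousLinearMap.star_eq_adjoint, hK hx i,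
      inner_zero_left]
  have h1 : ‖r x‖ ≤ ‖star (resolv L z) (p x)‖ := by
    rw [e]
    have := norm_add_sq_eq_norm_sq_add_norm_sq_of_inner_eq_zero _ _ ho
    nlinarith [norm_nonneg (r x + ∑ i, L i (q i x)), norm_nonneg (r x),
      mul_self_nonneg ‖∑ i, L i (q i x)‖]
  calc ‖r x‖ ≤ ‖star (resolv L z) (p x)‖ := h1
    _ ≤ ‖star (resolv L z)‖ * (‖p‖ * ‖x‖) :=
      ContinuousLinearMap.le_opNorm_of_le _ (p.le_opNorm x)
    _ = _ := by ring

/-- Division with remainder passes to norm closures. -/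
theorem mem_divSub_closure (hL : IsRowIsometry L) (hz : ‖z‖ < 1) {K : Submodule ℂ H}
    (hK : K ≤ kerStar L) {B S : Submodule ℂ (H →L[ℂ] H)} (hS : ∀ r ∈ S, ∀ x ∈ K, r x ∈ K)
    (hn : ∀ r ∈ S, ∀ C : ℝ, 0 ≤ C → (∀ x ∈ K, ‖r x‖ ≤ C * ‖x‖) → ‖r‖ ≤ C)
    (hB : B ≤ divSub L z B S) :
    B.topologicalClosure ≤ divSub L z B.topologicalClosure S.topologicalClosure := by
  intro a ha
  obtain ⟨p, hp, hpa⟩ := mem_closure_iff_seq_limit.1 ha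
  choose r hr q hq hpr using fun N => hB (hp N)
  set C := ‖star (resolv L z)‖ with hC
  have hd : ∀ N M, ‖r N - r M‖ ≤ C * ‖p N - p M‖ := by
    intro N M
    have hrm : r N - r M ∈ S := S.sub_mem (hr N) (hr M)
    refine hn _ hrm _ (by positivity) fun x hx => ?_
    refine norm_remainder_apply_le hL hz hK (q := q N - q M) ?_ (hS _ hrm x hx)
    rw [hpr N, hpr M]
    simp only [Pi.sub_apply, mul_sub, Finset.sum_sub_distrib]
    abel
  have hc : CauchySeq r := by
    have hpc := hpa.cauchySeq
    rw [cauchySeq_iff_tendsto_dist_atTop_0] at hpc ⊢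
    refine squeeze_zero (fun _ => dist_nonneg) (fun x => ?_)
      (by simpa using hpc.const_mul C)
    rw [dist_eq_norm, dist_eq_norm]
    exact hd _ _
  obtain ⟨r', hr'⟩ := cauchySeq_tendsto_of_complete hc
  -- The quotients depend continuously on dividend and remainder, so they converge as soon as the
  -- remainders do.
  have hq' : ∀ N j, q N j = star (L j) * (star (resolv L z) * (p N - r N)) := by
    intro N j
    have : p N - r N = ∑ i, (L i - z i • 1) * q N i := by
      conv_lhs => rw [hpr N]
      abel
    rw [this, star_resolv_mul_div hL hz, star_mul_sum_mul hL]
  have hlim : ∀ j, Filter.Tendsto (fun N => q N j) Filter.atTop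
      (nhds (star (L j) * (star (resolv L z) * (a - r')))) := by
    intro j
    simp only [hq']
    exact ((hpa.sub hr').const_mul _).const_mul _
  refine ⟨r', mem_closure_of_tendsto hr' (Filter.Eventually.of_forall hr), _, fun j =>
    mem_closure_of_tendsto (hlim j) (Filter.Eventually.of_forall fun N => hq N j), ?_⟩
  refine tendsto_nhds_unique hpa ?_
  have : p = fun N => r N + ∑ i, (L i - z i • 1) * q N i := funext hpr
  rw [this]
  exact hr'.add (tendsto_finsetSum _ fun i _ => (hlim i).const_mul _)

end Division

/-! ### Slices of vectors in the Fock space -/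

section Slice

variable {n m : ℕ}

theorem hasSum_norm_sq (x : Fock n m) : HasSum (fun p => ‖x p‖ ^ 2) (‖x‖ ^ 2) := by
  have h := lp.hasSum_norm (p := 2) (by norm_num) x
  simpa using h

/-- The part `∑ₐ x(a, b) e_a` of a vector `x`. -/
def slice (b : List (Fin m)) : Fock n m →ₗ[ℂ] Fock n m where
  toFun x := ⟨fun p => if p.2 = [] then x (p.1, b) else 0, by
    refine memℓp_gen ?_
    have h1 : Summable fun a => ‖x (a, b)‖ ^ 2 :=
      (hasSum_norm_sq x).summable.comp_injective (i := fun a => (a, b))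
        fun a a' h => (Prod.mk.inj h).1
    have hi : Function.Injective fun a : List (Fin n) => (a, ([] : List (Fin m))) :=
      fun a a' h => (Prod.mk.inj h).1
    refine (hi.summable_iff ?_).1 ?_
    · rintro ⟨a, c⟩ hc
      have : c ≠ [] := fun h => hc ⟨a, by rw [h]⟩
      simp [this]
    · simpa [Function.comp_def] using h1⟩
  map_add' x y := by
    refine lp.ext (funext fun p => ?_)
    change (if p.2 = [] then x (p.1, b) + y (p.1, b) else 0) =
      (if p.2 = [] then x (p.1, b) else 0) + (if p.2 = [] then y (p.1, b) else 0)
    split_ifs <;> simp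
  map_smul' c x := by
    refine lp.ext (funext fun p => ?_)
    change (if p.2 = [] then c • x (p.1, b) else 0) = c • (if p.2 = [] then x (p.1, b) else 0)
    split_ifs <;> simp

theorem slice_apply (b : List (Fin m)) (x : Fock n m) (p : List (Fin n) × List (Fin m)) :
    slice b x p = if p.2 = [] then x (p.1, b) else 0 := rfl

theorem slice_mem_eSpace (b : List (Fin m)) (x : Fock n m) : slice b x ∈ eSpace n m :=
  fun a c hc => by rw [slice_apply, if_neg hc]

theorem hasSum_norm_slice_sq (x : Fock n m) :
    HasSum (fun b => ‖slice b x‖ ^ 2) (‖x‖ ^ 2) := by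
  have h1 : HasSum (fun p : List (Fin m) × List (Fin n) => ‖x (p.2, p.1)‖ ^ 2) (‖x‖ ^ 2) :=
    (Equiv.prodComm (List (Fin m)) (List (Fin n))).hasSum_iff.2 (hasSum_norm_sq x)
  refine h1.prod_fiberwise fun b => ?_
  have h2 := hasSum_norm_sq (slice b x)
  have hi : Function.Injective fun a : List (Fin n) => (a, ([] : List (Fin m))) :=
    fun a a' h => (Prod.mk.inj h).1
  rw [← hi.hasSum_iff] at h2
  · simpa [Function.comp_def, slice_apply] using h2
  · rintro ⟨a, c⟩ hc
    have : c ≠ [] := fun h => hc ⟨a, by rw [h]⟩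
    simp [slice_apply, this]

/-- The algebra generated by the `L_{e_i}`. -/
def algE (n m : ℕ) : Subalgebra ℂ (Fock n m →L[ℂ] Fock n m) := Algebra.adjoin ℂ (Set.range Le)

/-- The algebra generated by the `L_{f_j}`. -/
def algF (u : Matrix.unitaryGroup (Fin n × Fin m) ℂ) : Subalgebra ℂ (Fock n m →L[ℂ] Fock n m) :=
  Algebra.adjoin ℂ (Set.range (Lf u))

theorem Le_mem_algE (i : Fin n) : Le i ∈ algE n m := Algebra.subset_adjoin ⟨i, rfl⟩

theorem Lf_mem_algF (u : Matrix.unitaryGroup (Fin n × Fin m) ℂ) (j : Fin m) :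
    Lf u j ∈ algF u := Algebra.subset_adjoin ⟨j, rfl⟩

theorem algE_le_polyAlg (u : Matrix.unitaryGroup (Fin n × Fin m) ℂ) : algE n m ≤ polyAlg u :=
  Algebra.adjoin_le (Set.range_subset_iff.2 (Le_mem u))

theorem slice_algE {r : Fock n m →L[ℂ] Fock n m} (hr : r ∈ algE n m) :
    ∀ (b : List (Fin m)) (x : Fock n m), slice b (r x) = r (slice b x) := by
  induction hr using Algebra.adjoin_induction with
  | mem r hr =>
    obtain ⟨i, rfl⟩ := hr
    intro b x
    refine lp.ext (funext fun p => ?_)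
    obtain ⟨a, c⟩ := p
    rw [slice_apply]
    cases a with
    | nil => simp [Le_apply_nil]
    | cons j a =>
      simp only [Le_apply_cons, slice_apply]
      split_ifs <;> rfl
  | algebraMap c =>
    intro b x
    rw [Algebra.algebraMap_eq_smul_one]
    simp
  | add r s _ _ h1 h2 => intro b x; simp [h1, h2]
  | mul r s _ _ h1 h2 => intro b x; simp [h1, h2]

/-- The Fock space is a Hilbert sum of copies of `eSpace`, one for each word `b`, and operators of
`algE` act in the same way on every copy. -/
theorem norm_le_of_eSpace {r : Fock n m →L[ℂ] Fock n m} (hr : r ∈ algE n m) {C : ℝ}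
    (hC : 0 ≤ C) (h : ∀ x ∈ eSpace n m, ‖r x‖ ≤ C * ‖x‖) : ‖r‖ ≤ C := by
  refine r.opNorm_le_bound hC fun x => ?_
  have h1 := hasSum_norm_slice_sq (r x)
  have h2 := (hasSum_norm_slice_sq x).mul_left (C ^ 2)
  have h3 : ‖r x‖ ^ 2 ≤ C ^ 2 * ‖x‖ ^ 2 := by
    refine hasSum_le (fun b => ?_) h1 h2
    rw [slice_algE hr, ← mul_pow]
    exact pow_le_pow_left₀ (norm_nonneg _) (h _ (slice_mem_eSpace b x)) 2
  rw [← mul_pow] at h3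
  exact abs_le_of_sq_le_sq' h3 (by positivity) |>.2

end Slice

/-! ### Division with remainder in the polynomial algebra and its norm closure -/

section Factor

variable {n m : ℕ} (u : Matrix.unitaryGroup (Fin n × Fin m) ℂ)

/-- Every polynomial is a combination of products `q r` with `q` a polynomial in the `f_j` and
`r` a polynomial in the `e_i`. -/
theorem polyAlg_le_algF_mul_algE :
    Subalgebra.toSubmodule (polyAlg u) ≤
      Subalgebra.toSubmodule (algF u) * Subalgebra.toSubmodule (algE n m) := by
  set N := Subalgebra.toSubmodule (algF u) * Subalgebra.toSubmodule (algE n m) with hN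
  have hmul : ∀ {q r}, q ∈ algF u → r ∈ algE n m → q * r ∈ N := fun hq hr =>
    Submodule.mul_mem_mul hq hr
  have hf : ∀ j, ∀ y ∈ N, Lf u j * y ∈ N := by
    intro j y hy
    induction hy using Submodule.mul_induction_on' with
    | mem_mul_mem q hq r hr =>
      rw [← mul_assoc]
      exact hmul ((algF u).mul_mem (Lf_mem_algF u j) hq) hr
    | add x _ y _ hx hy => rw [mul_add]; exact N.add_mem hx hy
  have hr : ∀ r ∈ algE n m, ∀ y ∈ N, y * r ∈ N := by
    intro r hr y hy
    induction hy using Submodule.mul_induction_on' with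
    | mem_mul_mem q hq r' hr' =>
      rw [mul_assoc]
      exact hmul hq ((algE n m).mul_mem hr' hr)
    | add x _ y _ hx hy => rw [add_mul]; exact N.add_mem hx hy
  have he : ∀ q ∈ algF u, ∀ i : Fin n, Le i * q ∈ N := by
    intro q hq
    -- All indices `i` are treated at once, because moving `e_i` past `f_j` produces every `e_k`.
    let M : Submodule ℂ (Fock n m →L[ℂ] Fock n m) :=
      ⨅ i : Fin n, N.comap (LinearMap.mulLeft ℂ (Le i))
    have hM : ∀ {q}, q ∈ M ↔ ∀ i : Fin n, Le i * q ∈ N := by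
      intro q; simp [M, Submodule.mem_iInf]
    refine hM.1 (mem_of_mem_adjoin_of_mul_left (M := M) ?_ ?_ hq)
    · rw [hM]
      intro i
      rw [mul_one, ← one_mul (Le i)]
      exact hmul (algF u).one_mem (Le_mem_algE i)
    · rintro _ ⟨j, rfl⟩ y hy
      rw [hM] at hy ⊢
      intro i
      rw [← mul_assoc, Le_mul_Lf, Finset.sum_mul]
      refine N.sum_mem fun p _ => ?_
      rw [smul_mul_assoc, mul_assoc]
      exact N.smul_mem _ (hf _ _ (hy _))
  intro x hx
  refine mem_of_mem_adjoin_of_mul_left ?_ ?_ hx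
  · rw [← one_mul (1 : Fock n m →L[ℂ] Fock n m)]
    exact hmul (algF u).one_mem (algE n m).one_mem
  · rintro g (⟨i, rfl⟩ | ⟨j, rfl⟩) y hy
    · induction hy using Submodule.mul_induction_on' with
      | mem_mul_mem q hq r hr' =>
        rw [← mul_assoc]
        exact hr r hr' _ (he q hq i)
      | add x _ y _ hx hy => rw [mul_add]; exact N.add_mem hx hy
    · exact hf j y hy

theorem polyAlg_le_divSub (w : EuclideanSpace ℂ (Fin m)) :
    Subalgebra.toSubmodule (polyAlg u) ≤ divSub (Lf u) w (Subalgebra.toSubmodule (polyAlg u))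
      (Subalgebra.toSubmodule (algE n m)) := by
  refine (polyAlg_le_algF_mul_algE u).trans (Submodule.mul_le.2 fun q hq r hr => ?_)
  let M : Submodule ℂ (Fock n m →L[ℂ] Fock n m) :=
    (divSub (Lf u) w (Subalgebra.toSubmodule (polyAlg u)) (Subalgebra.toSubmodule (algE n m)) ⊓
      Subalgebra.toSubmodule (polyAlg u)).comap (LinearMap.mulRight ℂ r)
  have hM : q ∈ M := by
    refine mem_of_mem_adjoin_of_mul_left (M := M) ?_ ?_ hq
    · refine ⟨?_, ?_⟩
      · simpa using mem_divSub_of_mem hr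
      · simpa using algE_le_polyAlg u hr
    · rintro _ ⟨j, rfl⟩ y ⟨hy1, hy2⟩
      simp only [LinearMap.mulRight_apply] at hy1 hy2
      refine ⟨?_, ?_⟩
      · rw [LinearMap.mulRight_apply, mul_assoc]
        exact mul_mem_divSub hy1 hy2 j
      · rw [LinearMap.mulRight_apply, mul_assoc]
        exact (polyAlg u).mul_mem (Lf_mem u j) hy2
  exact hM.1

theorem algE_le_divSub (z : EuclideanSpace ℂ (Fin n)) :
    Subalgebra.toSubmodule (algE n m) ≤ divSub Le z (Subalgebra.toSubmodule (algE n m))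
      (ℂ ∙ (1 : Fock n m →L[ℂ] Fock n m)) := by
  intro q hq
  have : q ∈ divSub Le z (Subalgebra.toSubmodule (algE n m))
      (ℂ ∙ (1 : Fock n m →L[ℂ] Fock n m)) ⊓ Subalgebra.toSubmodule (algE n m) := by
    refine mem_of_mem_adjoin_of_mul_left ?_ ?_ hq
    · exact ⟨mem_divSub_of_mem (Submodule.mem_span_singleton_self _), (algE n m).one_mem⟩
    · rintro _ ⟨i, rfl⟩ y ⟨hy1, hy2⟩
      exact ⟨mul_mem_divSub hy1 hy2 i, (algE n m).mul_mem (Le_mem_algE i) hy2⟩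
  exact this.1

variable {u}

/-- Every element of `𝒜ᵤ` is a scalar plus an element of the right ideal generated by the
`L_{e_i} - zᵢ` and `L_{f_j} - wⱼ`, for `(z, w)` in the open balls. -/
theorem exists_factorization {p : Pt n m} (h1 : ‖p.1‖ < 1) (h2 : ‖p.2‖ < 1)
    {a : Fock n m →L[ℂ] Fock n m} (ha : a ∈ normAlg u) :
    ∃ (c : ℂ) (q : Fin n → normAlg u) (r : Fin m → normAlg u),
      a = c • 1 + ∑ i, (Le i - p.1 i • 1) * (q i : Fock n m →L[ℂ] Fock n m) +
        ∑ j, (Lf u j - p.2 j • 1) * (r j : Fock n m →L[ℂ] Fock n m) := by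
  have hinv : ∀ r ∈ Subalgebra.toSubmodule (algE n m), ∀ x ∈ eSpace n m, r x ∈ eSpace n m := by
    intro r hr
    have h : algE n m ≤ invAlg (eSpace n m) :=
      Algebra.adjoin_le (Set.range_subset_iff.2 Le_mem_invAlg_eSpace)
    exact h hr
  -- First division: by the `f` shifts, with remainder in the closure of `algE`, whose elements are
  -- tested on `eSpace`.
  obtain ⟨b, hb, r, hr, rfl⟩ := mem_divSub_closure (isRowIsometry_Lf u) h2 (eSpace_le_kerStar u)
    hinv (fun r hr C hC h => norm_le_of_eSpace hr hC h) (polyAlg_le_divSub u p.2) ha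
  have hK : (ℂ ∙ vac n m) ≤ kerStar (Le : Fin n → Fock n m →L[ℂ] Fock n m) :=
    (Submodule.span_singleton_le_iff_mem _ _).2 vac_mem_kerStar
  have hone : ∀ r ∈ (ℂ ∙ (1 : Fock n m →L[ℂ] Fock n m)), ∃ c : ℂ, r = c • 1 := fun r hr => by
    obtain ⟨c, rfl⟩ := Submodule.mem_span_singleton.1 hr
    exact ⟨c, rfl⟩
  -- Second division: that remainder by the `e` shifts. Now the remainders are scalars, and the
  -- vacuum line suffices to measure them.
  obtain ⟨b', hb', q, hq, rfl⟩ := mem_divSub_closure (isRowIsometry_Le (n := n) (m := m)) h1 hK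
    (fun r hr x hx => by
      obtain ⟨c, rfl⟩ := hone r hr
      exact Submodule.smul_mem _ c hx)
    (fun r hr C hC h => by
      obtain ⟨c, rfl⟩ := hone r hr
      have h3 := h _ (Submodule.mem_span_singleton_self _)
      rw [smul_apply, one_apply_eq_self, norm_smul, norm_vac, mul_one, mul_one] at h3
      refine (norm_smul_le _ _).trans ((mul_le_of_le_one_right (norm_nonneg c) ?_).trans h3)
      exact ContinuousLinearMap.norm_id_le) (algE_le_divSub p.1) hb
  have hfin : (ℂ ∙ (1 : Fock n m →L[ℂ] Fock n m)).topologicalClosure =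
      ℂ ∙ (1 : Fock n m →L[ℂ] Fock n m) :=
    (Submodule.closed_of_finiteDimensional _).submodule_topologicalClosure_eq
  rw [hfin] at hb'
  obtain ⟨c, rfl⟩ := hone b' hb'
  have hcl : ∀ x ∈ (Subalgebra.toSubmodule (algE n m)).topologicalClosure, x ∈ normAlg u :=
    fun x hx => closure_mono (algE_le_polyAlg u) hx
  exact ⟨c, fun i => ⟨q i, hcl _ (hq i)⟩, fun j => ⟨r j, hr j⟩, rfl⟩

end Factor

/-! ### Point derivations -/

section Abstract

variable {A : Type*} [Ring A] [Algebra ℂ A] {ι κ : Type*} [Fintype ι] [Fintype κ]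

theorem algHom_factorization (φ : A →ₐ[ℂ] ℂ) (c : ℂ) (e q : ι → A) (f r : κ → A) :
    φ (c • 1 + ∑ i, (e i - φ (e i) • 1) * q i + ∑ j, (f j - φ (f j) • 1) * r j) = c := by
  simp

theorem algHom_smul (φ : A →ₐ[ℂ] ℂ) (c : ℂ) (a : A) : φ (c • a) = c * φ a := by simp

theorem algHom_add (φ : A →ₐ[ℂ] ℂ) (a b : A) : φ (a + b) = φ a + φ b := map_add φ a b

theorem algHom_smul_sum (φ : A →ₐ[ℂ] ℂ) (c : ℂ) (d : ι → ℂ) (e : ι → A) :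
    φ (c • ∑ i, d i • e i) = c * ∑ i, d i * φ (e i) := by simp

/-- Point derivations at a character. -/
def IsPointDer (φ : A →ₐ[ℂ] ℂ) (δ : A →ₗ[ℂ] ℂ) : Prop :=
  ∀ a b, δ (a * b) = φ a * δ b + δ a * φ b

theorem IsPointDer.map_one {φ : A →ₐ[ℂ] ℂ} {δ : A →ₗ[ℂ] ℂ} (h : IsPointDer φ δ) : δ 1 = 0 := by
  have := h 1 1
  rw [mul_one, _root_.map_one φ] at this
  linear_combination -this

/-- In each product the left factor is killed by both `φ` and `δ`, so the Leibniz rule leaves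
nothing. No continuity is needed. -/
theorem IsPointDer.factorization {φ : A →ₐ[ℂ] ℂ} {δ : A →ₗ[ℂ] ℂ} (h : IsPointDer φ δ) (c : ℂ)
    {e : ι → A} (q : ι → A) {f : κ → A} (r : κ → A) (he : ∀ i, δ (e i) = 0)
    (hf : ∀ j, δ (f j) = 0) :
    δ (c • 1 + ∑ i, (e i - φ (e i) • 1) * q i + ∑ j, (f j - φ (f j) • 1) * r j) = 0 := by
  have hs : ∀ b c, δ (b * c) = φ b * δ c + δ b * φ c := h
  simp [hs, he, hf, h.map_one]

end Abstract

/-! ### Derivations at the origin and the core equations -/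

section Derivation

variable {n m : ℕ} {u : Matrix.unitaryGroup (Fin n × Fin m) ℂ}

/-- `L_{e_i}` as an element of `𝒜ᵤ`. -/
def genE (u : Matrix.unitaryGroup (Fin n × Fin m) ℂ) (i : Fin n) : normAlg u :=
  ⟨Le i, polyAlg_le_normAlg u (Le_mem u i)⟩

/-- `L_{f_j}` as an element of `𝒜ᵤ`. -/
def genF (u : Matrix.unitaryGroup (Fin n × Fin m) ℂ) (j : Fin m) : normAlg u :=
  ⟨Lf u j, polyAlg_le_normAlg u (Lf_mem u j)⟩

theorem genE_mul_genF (i : Fin n) (j : Fin m) :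
    genE u i * genF u j = ∑ q : Fin n × Fin m, u.1 (i, j) q • (genF u q.2 * genE u q.1) := by
  refine Subtype.ext ?_
  rw [AddSubmonoidClass.coe_finsetSum]
  exact Le_mul_Lf u i j

theorem charPoint_fst (φ : normAlg u →ₐ[ℂ] ℂ) (i : Fin n) :
    (charPoint u (polyAlg_le_normAlg u) φ).1 i = φ (genE u i) := rfl

theorem charPoint_snd (φ : normAlg u →ₐ[ℂ] ℂ) (j : Fin m) :
    (charPoint u (polyAlg_le_normAlg u) φ).2 j = φ (genF u j) := rfl

theorem exists_factorization_normAlg {p : Pt n m} (h1 : ‖p.1‖ < 1) (h2 : ‖p.2‖ < 1)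
    (a : normAlg u) : ∃ (c : ℂ) (q : Fin n → normAlg u) (r : Fin m → normAlg u),
      a = c • 1 + ∑ i, (genE u i - p.1 i • 1) * q i + ∑ j, (genF u j - p.2 j • 1) * r j := by
  obtain ⟨c, q, r, h⟩ := exists_factorization h1 h2 a.2
  refine ⟨c, q, r, Subtype.ext ?_⟩
  rw [h]
  push_cast
  rfl

/-- Characters of `𝒜ᵤ` with the same point in the open balls agree. -/
theorem character_ext {φ ψ : normAlg u →ₐ[ℂ] ℂ}
    (h : charPoint u (polyAlg_le_normAlg u) φ = charPoint u (polyAlg_le_normAlg u) ψ)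
    (h1 : ‖(charPoint u (polyAlg_le_normAlg u) φ).1‖ < 1)
    (h2 : ‖(charPoint u (polyAlg_le_normAlg u) φ).2‖ < 1) : φ = ψ := by
  ext a
  obtain ⟨c, q, r, rfl⟩ := exists_factorization_normAlg h1 h2 a
  refine (algHom_factorization φ c (genE u) q (genF u) r).trans ?_
  rw [h]
  exact (algHom_factorization ψ c (genE u) q (genF u) r).symm

/-- A point derivation at a point of the open balls is determined by its values on the shifts. -/
theorem IsPointDer.eq_zero {φ : normAlg u →ₐ[ℂ] ℂ} {δ : normAlg u →ₗ[ℂ] ℂ}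
    (h : IsPointDer φ δ) (h1 : ‖(charPoint u (polyAlg_le_normAlg u) φ).1‖ < 1)
    (h2 : ‖(charPoint u (polyAlg_le_normAlg u) φ).2‖ < 1)
    (hE : ∀ i, δ (genE u i) = 0) (hF : ∀ j, δ (genF u j) = 0) : δ = 0 := by
  ext a
  obtain ⟨c, q, r, rfl⟩ := exists_factorization_normAlg h1 h2 a
  exact h.factorization c q r hE hF

/-- The functional `T ↦ ⟨v, T Ω⟩`. -/
def vecFun (u : Matrix.unitaryGroup (Fin n × Fin m) ℂ) (v : Fock n m) : normAlg u →ₗ[ℂ] ℂ where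
  toFun T := inner ℂ v ((T : Fock n m →L[ℂ] Fock n m) (vac n m))
  map_add' _ _ := inner_add_right _ _ _
  map_smul' _ _ := inner_smul_right _ _ _

/-- Vectors of degree one: they are sent to multiples of the vacuum by the adjoints of the
shifts. -/
structure IsPrimitive (u : Matrix.unitaryGroup (Fin n × Fin m) ℂ) (v : Fock n m) : Prop where
  vac_eq : inner ℂ v (vac n m) = 0
  Le_eq : ∀ k y, inner ℂ v (Le k y) = inner ℂ v (Le k (vac n m)) * inner ℂ (vac n m) y
  Lf_eq : ∀ l y, inner ℂ v (Lf u l y) = inner ℂ v (Lf u l (vac n m)) * inner ℂ (vac n m) y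

/-- The algebra of operators on which the Leibniz rule holds. -/
def leibnizAlg {v : Fock n m} (hv : inner ℂ v (vac n m) = 0) :
    Subalgebra ℂ (Fock n m →L[ℂ] Fock n m) where
  carrier := {T | T ∈ vacAlg n m ∧ ∀ y, inner ℂ v (T y) =
    inner ℂ (vac n m) (T (vac n m)) * inner ℂ v y + inner ℂ v (T (vac n m)) * inner ℂ (vac n m) y}
  mul_mem' {S T} hS hT := by
    refine ⟨(vacAlg n m).mul_mem hS.1 hT.1, fun y => ?_⟩
    rw [mul_apply_eq_comp, mul_apply_eq_comp, hS.2 (T y), hT.2 y, hS.2 (T (vac n m)),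
      hT.1 y, hS.1 (T (vac n m))]
    ring
  add_mem' {S T} hS hT := by
    refine ⟨(vacAlg n m).add_mem hS.1 hT.1, fun y => ?_⟩
    simp only [add_apply, inner_add_right, hS.2 y, hT.2 y]
    ring
  algebraMap_mem' c := by
    refine ⟨(vacAlg n m).algebraMap_mem c, fun y => ?_⟩
    rw [Algebra.algebraMap_eq_smul_one]
    simp only [smul_apply, one_apply_eq_self, inner_smul_right, inner_vac_vac, hv]
    ring

theorem isClosed_vacAlg_norm : IsClosed (vacAlg n m : Set (Fock n m →L[ℂ] Fock n m)) :=
  IsClosed.mono isClosed_vacAlg norm_topology_le_weakStar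

theorem isClosed_leibnizAlg {v : Fock n m} (hv : inner ℂ v (vac n m) = 0) :
    IsClosed (leibnizAlg hv : Set (Fock n m →L[ℂ] Fock n m)) := by
  have : (leibnizAlg hv : Set (Fock n m →L[ℂ] Fock n m)) = (vacAlg n m : Set _) ∩
      ⋂ y, {T | inner ℂ v (T y) = inner ℂ (vac n m) (T (vac n m)) * inner ℂ v y +
        inner ℂ v (T (vac n m)) * inner ℂ (vac n m) y} := by
    ext T
    simp only [Set.mem_inter_iff, Set.mem_iInter, Set.mem_ofPred_eq, SetLike.mem_coe]
    rfl
  rw [this]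
  exact isClosed_vacAlg_norm.inter
    (isClosed_iInter fun y => isClosed_eq (by fun_prop) (by fun_prop))

/-- The vacuum character of `𝒜ᵤ`. -/
def normVacChar (u : Matrix.unitaryGroup (Fin n × Fin m) ℂ) : normAlg u →ₐ[ℂ] ℂ :=
  (wstarVacChar u).comp (Subalgebra.inclusion (normAlg_le_wstarAlg u))

theorem charPoint_normVacChar : charPoint u (polyAlg_le_normAlg u) (normVacChar u) = 0 :=
  Prod.ext (PiLp.ext fun k => inner_vac_Le k _) (PiLp.ext fun l => inner_vac_Lf u l _)

/-- The Leibniz identity is proved with an arbitrary vector `y` in place of `b` applied to the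
vacuum. In this form it defines a closed subalgebra, so checking the shifts is enough. -/
theorem IsPrimitive.isPointDer {v : Fock n m} (hv : IsPrimitive u v) :
    IsPointDer (normVacChar u) (vecFun u v) := by
  have h : normAlg u ≤ leibnizAlg hv.vac_eq :=
    Subalgebra.topologicalClosure_minimal
      (polyAlg_le
        (fun k => ⟨Le_mem_vacAlg k, fun y => by
          rw [hv.Le_eq k y, inner_vac_Le, zero_mul, zero_add]⟩)
        (fun l => ⟨Lf_mem_vacAlg u l, fun y => by
          rw [hv.Lf_eq l y, inner_vac_Lf, zero_mul, zero_add]⟩))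
      (isClosed_leibnizAlg _)
  intro a b
  refine ((h a.2).2 ((b : Fock n m →L[ℂ] Fock n m) (vac n m))).trans ?_
  rfl

theorem isPrimitive_e (i : Fin n) : IsPrimitive u (basisVec [i] []) where
  vac_eq := by rw [vac, inner_basisVec_basisVec]; simp
  Le_eq k y := by
    simp only [inner_basisVec, Le_apply_cons, vac]
    rw [← inner_basisVec [] [] (basisVec [] []), inner_basisVec_basisVec]
    split_ifs <;> simp_all
  Lf_eq l y := by simp only [inner_basisVec, Lf_apply_nil, zero_mul]

theorem inner_basisVec_Lf (j l : Fin m) (y : Fock n m) :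
    inner ℂ (basisVec [] [j]) (Lf u l y) = if j = l then inner ℂ (vac n m) y else 0 := by
  rw [← Lf_basisVec_nil u, ← ContinuousLinearMap.adjoint_inner_right,
    ← ContinuousLinearMap.star_eq_adjoint, ← mul_apply_eq_comp, star_Lf_mul_Lf]
  split_ifs
  · rfl
  · simp

theorem isPrimitive_f (j : Fin m) : IsPrimitive u (basisVec [] [j]) where
  vac_eq := by rw [vac, inner_basisVec_basisVec]; simp
  Le_eq k y := by simp only [inner_basisVec, Le_apply_nil, zero_mul]
  Lf_eq l y := by
    simp only [inner_basisVec_Lf, inner_vac_vac]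
    split_ifs <;> simp

/-- The point derivation at the origin with prescribed values on the shifts. -/
def originDer (u : Matrix.unitaryGroup (Fin n × Fin m) ℂ) :
    ((Fin n → ℂ) × (Fin m → ℂ)) →ₗ[ℂ] (normAlg u →ₗ[ℂ] ℂ) where
  toFun x := ∑ i, x.1 i • vecFun u (basisVec [i] []) + ∑ j, x.2 j • vecFun u (basisVec [] [j])
  map_add' x y := by
    simp only [Prod.fst_add, Prod.snd_add, Pi.add_apply, add_smul, Finset.sum_add_distrib]
    abel
  map_smul' c x := by
    simp only [Prod.smul_fst, Prod.smul_snd, Pi.smul_apply, smul_eq_mul, mul_smul,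
      ← Finset.smul_sum, smul_add, RingHom.id_apply]

theorem originDer_apply (x : (Fin n → ℂ) × (Fin m → ℂ)) (a : normAlg u) :
    originDer u x a = ∑ i, x.1 i * vecFun u (basisVec [i] []) a +
      ∑ j, x.2 j * vecFun u (basisVec [] [j]) a := by
  simp [originDer, LinearMap.sum_apply]

theorem isPointDer_originDer (x : (Fin n → ℂ) × (Fin m → ℂ)) :
    IsPointDer (normVacChar u) (originDer u x) := by
  intro a b
  simp only [originDer_apply]
  simp only [(isPrimitive_e _).isPointDer a b, (isPrimitive_f _).isPointDer a b, mul_add,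
    Finset.sum_add_distrib, Finset.mul_sum, add_mul, Finset.sum_mul]
  have e : ∀ (c d e : ℂ), c * (d * e) = d * (c * e) := fun c d e => by ring
  have e' : ∀ (c d e : ℂ), c * (d * e) = c * d * e := fun c d e => by ring
  simp only [e _ (normVacChar u a) _, e' _ _ (normVacChar u b)]
  ring

theorem originDer_genE (x : (Fin n → ℂ) × (Fin m → ℂ)) (k : Fin n) :
    originDer u x (genE u k) = x.1 k := by
  rw [originDer_apply]
  have h1 : ∀ i, vecFun u (basisVec [i] []) (genE u k) = if i = k then 1 else 0 := by
    intro i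
    change inner ℂ (basisVec [i] []) (Le k (basisVec [] [])) = _
    rw [Le_basisVec, inner_basisVec_basisVec]; simp
  have h2 : ∀ j, vecFun u (basisVec [] [j]) (genE u k) = 0 := by
    intro j
    change inner ℂ (basisVec [] [j]) (Le k (basisVec [] [])) = _
    rw [Le_basisVec, inner_basisVec_basisVec]; simp
  simp [h1, h2]

theorem originDer_genF (x : (Fin n → ℂ) × (Fin m → ℂ)) (l : Fin m) :
    originDer u x (genF u l) = x.2 l := by
  rw [originDer_apply]
  have h1 : ∀ i, vecFun u (basisVec [i] []) (genF u l) = 0 := by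
    intro i
    change inner ℂ (basisVec [i] []) (Lf u l (basisVec [] [])) = _
    rw [Lf_basisVec_nil, inner_basisVec_basisVec]; simp
  have h2 : ∀ j, vecFun u (basisVec [] [j]) (genF u l) = if j = l then 1 else 0 := by
    intro j
    change inner ℂ (basisVec [] [j]) (Lf u l (basisVec [] [])) = _
    rw [Lf_basisVec_nil, inner_basisVec_basisVec]; simp
  simp [h1, h2]

/-- The derivations at the origin, composed with `Ψ⁻¹`, are derivations at `p` and still take
arbitrary values on the generators. The commutation relations must then survive to first order in
every direction, which forces the core equations. -/
theorem mem_core_of_moves {Ψ : normAlg u ≃ₐ[ℂ] normAlg u} {p : Pt n m} (hΨ : Moves u Ψ 0 p)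
    (hp : p ∈ openBalls n m) : p ∈ core u := by
  obtain ⟨φ, h0, hφ⟩ := hΨ
  have h1 : ‖p.1‖ < 1 := mem_ball_zero_iff.1 hp.1
  have h2 : ‖p.2‖ < 1 := mem_ball_zero_iff.1 hp.2
  obtain rfl : φ = normVacChar u := character_ext (by rw [h0, charPoint_normVacChar])
    (by rw [h0]; simp) (by rw [h0]; simp)
  set ψ := (normVacChar u).comp Ψ.symm.toAlgHom with hψ
  have hE : ∀ i, ψ (genE u i) = p.1 i := fun i => by rw [← charPoint_fst, hφ]
  have hF : ∀ j, ψ (genF u j) = p.2 j := fun j => by rw [← charPoint_snd, hφ]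
  let der : ((Fin n → ℂ) × (Fin m → ℂ)) →ₗ[ℂ] (normAlg u →ₗ[ℂ] ℂ) :=
    (LinearMap.lcomp ℂ ℂ Ψ.symm.toLinearMap) ∘ₗ originDer u
  have der_apply : ∀ x a, der x a = originDer u x (Ψ.symm a) := fun x a => rfl
  have hder : ∀ x, IsPointDer ψ (der x) := fun x a b => by
    rw [der_apply, map_mul, isPointDer_originDer]; rfl
  let T : ((Fin n → ℂ) × (Fin m → ℂ)) →ₗ[ℂ] ((Fin n → ℂ) × (Fin m → ℂ)) :=
    (LinearMap.pi fun i => (LinearMap.applyₗ (genE u i)) ∘ₗ der).prod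
      (LinearMap.pi fun j => (LinearMap.applyₗ (genF u j)) ∘ₗ der)
  have hT : Function.Injective T := by
    rw [← LinearMap.ker_eq_bot, LinearMap.ker_eq_bot']
    intro x hx
    have hd : der x = 0 := (hder x).eq_zero (by rw [hφ]; exact h1) (by rw [hφ]; exact h2)
      (fun i => congrFun (congrArg Prod.fst hx) i) (fun j => congrFun (congrArg Prod.snd hx) j)
    have ho : ∀ a, originDer u x a = 0 := fun a => by
      have := der_apply x (Ψ a)
      rw [hd, AlgEquiv.symm_apply_apply] at this
      exact this.symm
    refine Prod.ext (funext fun i => ?_) (funext fun j => ?_)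
    · rw [← originDer_genE x i, ho]; rfl
    · rw [← originDer_genF x j, ho]; rfl
  -- `T` records the values of the transported derivation on the generators; it is an injective
  -- endomorphism of a space of dimension `n + m`.
  have hsurj := LinearMap.injective_iff_surjective.1 hT
  have rel : ∀ (α : Fin n → ℂ) (β : Fin m → ℂ) (i : Fin n) (j : Fin m),
      p.1 i * β j + α i * p.2 j =
        ∑ q : Fin n × Fin m, u.1 (i, j) q * (p.2 q.2 * α q.1 + β q.2 * p.1 q.1) := by
    intro α β i j
    obtain ⟨x, hx⟩ := hsurj (α, β)
    have hα : ∀ i, der x (genE u i) = α i := fun i => congrFun (congrArg Prod.fst hx) i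
    have hβ : ∀ j, der x (genF u j) = β j := fun j => congrFun (congrArg Prod.snd hx) j
    have := congrArg (der x) (genE_mul_genF (u := u) i j)
    rw [hder x, map_sum, hE, hF, hα, hβ] at this
    rw [this]
    refine Finset.sum_congr rfl fun q _ => ?_
    rw [map_smul, hder x, hE, hF, hα, hβ, smul_eq_mul]
  refine ⟨⟨Metric.ball_subset_closedBall hp.1, Metric.ball_subset_closedBall hp.2⟩,
    fun i j => ⟨funext fun k => ?_, funext fun l => ?_⟩⟩
  -- Varying only `e_k` isolates the equation for `w`; below, varying only `f_l` isolates the one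
  -- for `z`.
  · have h := rel (Pi.single k 1) 0 i j
    rw [Fintype.sum_prod_type, Finset.sum_eq_single k (by intro b _ hb; simp [hb]) (by simp)] at h
    simp only [Pi.zero_apply, mul_zero, zero_add, zero_mul, add_zero, Pi.single_eq_same,
      mul_one] at h
    simp only [cMat, Matrix.sub_mulVec, Pi.sub_apply, Pi.zero_apply, sub_eq_zero]
    simp only [Matrix.mulVec, dotProduct, Matrix.of_apply]
    rw [← h]
    simp [Matrix.single_apply, ite_and, Pi.single_apply]
  · have h := rel 0 (Pi.single l 1) i j
    rw [Fintype.sum_prod_type_right, Finset.sum_eq_single l (by intro b _ hb; simp [hb])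
      (by simp)] at h
    simp only [Pi.zero_apply, mul_zero, zero_add, zero_mul, add_zero, Pi.single_eq_same,
      one_mul] at h
    simp only [cMat, Matrix.transpose_sub, Matrix.sub_mulVec, Pi.sub_apply, Pi.zero_apply,
      sub_eq_zero]
    simp only [Matrix.mulVec, dotProduct, Matrix.of_apply, Matrix.transpose_apply]
    rw [← h]
    simp [Matrix.single_apply, ite_and, Pi.single_apply]

end Derivation

/-! ### The gauge automorphisms and the maximum principle -/

section Gauge

variable {n m : ℕ} {u : Matrix.unitaryGroup (Fin n × Fin m) ℂ}

/-- The commutation relations are homogeneous of degree two, so scaling all shifts by one unimodular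
`c` preserves them. -/
theorem isWandering_gauge {c : ℂ} (hc : ‖c‖ = 1) :
    IsWandering u (fun i => c • Le i) (fun j => c • Lf u j) (vac n m) := by
  have hcc : conj c * c = 1 := by
    rw [mul_comm, Complex.mul_conj, Complex.normSq_eq_norm_sq, hc]; simp
  refine ⟨fun i j => ?_, fun i j => ?_, fun l k => ?_, norm_vac, fun l => ?_, fun k b => ?_⟩
  · rw [star_smul, smul_mul_smul_comm, RCLike.star_def, hcc, one_smul, star_Le_mul_Le]
  · rw [star_smul, smul_mul_smul_comm, RCLike.star_def, hcc, one_smul, star_Lf_mul_Lf]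
  · simp only [smul_mul_smul_comm, Lf_mul_Le, Finset.smul_sum]
    exact Finset.sum_congr rfl fun p _ => smul_comm _ _ _
  · rw [star_smul, smul_apply, star_Lf_vac, smul_zero]
  · have hb : (b.map fun j => c • Lf u j).prod ∈
        invAlg (kerStar (Le : Fin n → Fock n m →L[ℂ] Fock n m)) :=
      Subalgebra.list_prod_mem _ fun T hT => by
        obtain ⟨l, _, rfl⟩ := List.mem_map.1 hT
        exact Subalgebra.smul_mem _ (Lf_mem_invAlg_kerStar u l) c
    rw [star_smul, smul_apply, hb _ vac_mem_kerStar k, smul_zero]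

/-- The gauge automorphism `L_{e_i} ↦ c L_{e_i}`, `L_{f_j} ↦ c L_{f_j}` for `|c| = 1`. -/
theorem exists_gauge (u : Matrix.unitaryGroup (Fin n × Fin m) ℂ) {c : ℂ} (hc : ‖c‖ = 1) :
    ∃ Γ : normAlg u →ₐ[ℂ] normAlg u, (∀ i, Γ (genE u i) = c • genE u i) ∧
      ∀ j, Γ (genF u j) = c • genF u j := by
  have hcc : conj c * c = 1 := by
    rw [mul_comm, Complex.mul_conj, Complex.normSq_eq_norm_sq, hc]; simp
  obtain ⟨U, hU, hE, hF, hv⟩ := (isWandering_gauge (u := u) hc).exists_intertwiner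
  have hE' : ∀ i, Le i * U = U * (conj c • Le i) := fun i => by
    rw [mul_smul_comm, hE, smul_mul_assoc, smul_smul, hcc, one_smul]
  have hF' : ∀ j, Lf u j * U = U * (conj c • Lf u j) := fun j => by
    rw [mul_smul_comm, hF, smul_mul_assoc, smul_smul, hcc, one_smul]
  have hU' := mul_star_eq_one_of_invariant hU hE' hF' hv
  have hm : U ∈ unitary (Fock n m →L[ℂ] Fock n m) := Unitary.mem_iff.2 ⟨hU, hU'⟩
  have e1 : ∀ i, U * Le i * star U = c • Le i := fun i => by
    rw [hE, mul_assoc, hU', mul_one]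
  have e2 : ∀ j, U * Lf u j * star U = c • Lf u j := fun j => by
    rw [hF, mul_assoc, hU', mul_one]
  have hn : ∀ T : normAlg u, U * (T : Fock n m →L[ℂ] Fock n m) * star U ∈ normAlg u := fun T =>
    normAlg_conj_mem (fun i => by rw [e1]; exact Subalgebra.smul_mem _ (genE u i).2 c)
      (fun j => by rw [e2]; exact Subalgebra.smul_mem _ (genF u j).2 c) hm T.2
  exact ⟨((conjAut hm).toAlgHom.comp (normAlg u).val).codRestrict (normAlg u) hn,
    fun i => Subtype.ext (e1 i), fun j => Subtype.ext (e2 j)⟩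

theorem norm_character_le (χ : normAlg u →ₐ[ℂ] ℂ) (a : normAlg u) :
    ‖χ a‖ ≤ ‖(a : Fock n m →L[ℂ] Fock n m)‖ := by
  have : CompleteSpace (normAlg u) := (isClosed_normAlg u).completeSpace_coe
  have hnt : Nontrivial (Fock n m) := ⟨vac n m, 0, fun h => by
    have := norm_vac (n := n) (m := m); rw [h, norm_zero] at this; exact zero_ne_one this⟩
  have : NormOneClass (normAlg u) := ⟨ContinuousLinearMap.norm_id⟩
  exact AlgHom.norm_apply_le_self χ a

/-- Along a gauge orbit a character is polynomial on the polynomial algebra. -/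
theorem exists_polynomial_gauge (χ φ : normAlg u →ₐ[ℂ] ℂ)
    (hφ : charPoint u (polyAlg_le_normAlg u) φ = 0) {a : Fock n m →L[ℂ] Fock n m}
    (ha : a ∈ polyAlg u) : ∃ P : Polynomial ℂ,
      P.eval 0 = φ ⟨a, polyAlg_le_normAlg u ha⟩ ∧
      ∀ (c : ℂ) (Γ : normAlg u →ₐ[ℂ] normAlg u), (∀ i, Γ (genE u i) = c • genE u i) →
        (∀ j, Γ (genF u j) = c • genF u j) →
        χ (Γ ⟨a, polyAlg_le_normAlg u ha⟩) = P.eval c := by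
  have h1 : ∀ i, φ (genE u i) = 0 := fun i => by rw [← charPoint_fst, hφ]; rfl
  have h2 : ∀ j, φ (genF u j) = 0 := fun j => by rw [← charPoint_snd, hφ]; rfl
  induction ha using Algebra.adjoin_induction with
  | mem x hx =>
    rcases hx with ⟨i, rfl⟩ | ⟨j, rfl⟩
    · refine ⟨Polynomial.X * Polynomial.C (χ (genE u i)), ?_, fun c Γ hE _ => ?_⟩
      · simp only [Polynomial.eval_mul, Polynomial.eval_X, zero_mul]
        exact (h1 i).symm
      · refine (congrArg χ (hE i)).trans ?_
        rw [algHom_smul, Polynomial.eval_mul, Polynomial.eval_X, Polynomial.eval_C]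
    · refine ⟨Polynomial.X * Polynomial.C (χ (genF u j)), ?_, fun c Γ _ hF => ?_⟩
      · simp only [Polynomial.eval_mul, Polynomial.eval_X, zero_mul]
        exact (h2 j).symm
      · refine (congrArg χ (hF j)).trans ?_
        rw [algHom_smul, Polynomial.eval_mul, Polynomial.eval_X, Polynomial.eval_C]
  | algebraMap r =>
    refine ⟨Polynomial.C r, ?_, fun c Γ _ _ => ?_⟩
    · rw [Polynomial.eval_C]; exact (φ.commutes r).symm
    · rw [Polynomial.eval_C]; exact (χ.comp Γ).commutes r
  | add x y hx hy ihx ihy =>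
    obtain ⟨P, hP, hP'⟩ := ihx
    obtain ⟨Q, hQ, hQ'⟩ := ihy
    refine ⟨P + Q, ?_, fun c Γ hE hF => ?_⟩
    · rw [Polynomial.eval_add, hP, hQ]
      exact (algHom_add φ _ _).symm
    · rw [Polynomial.eval_add, ← hP' c Γ hE hF, ← hQ' c Γ hE hF]
      exact algHom_add (χ.comp Γ) ⟨x, polyAlg_le_normAlg u hx⟩ ⟨y, polyAlg_le_normAlg u hy⟩
  | mul x y hx hy ihx ihy =>
    obtain ⟨P, hP, hP'⟩ := ihx
    obtain ⟨Q, hQ, hQ'⟩ := ihy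
    refine ⟨P * Q, ?_, fun c Γ hE hF => ?_⟩
    · rw [Polynomial.eval_mul, hP, hQ]
      exact (map_mul φ _ _).symm
    · rw [Polynomial.eval_mul, ← hP' c Γ hE hF, ← hQ' c Γ hE hF]
      exact map_mul (χ.comp Γ) ⟨x, polyAlg_le_normAlg u hx⟩ ⟨y, polyAlg_le_normAlg u hy⟩

/-- A sequence of polynomials that is Cauchy on the unit circle converges on the closed disc; if
the limit has modulus at most one on the circle and is one at the origin, it is one throughout. -/
theorem tendsto_one_of_circle {P : ℕ → Polynomial ℂ} {d : ℕ × ℕ → ℝ}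
    (hd : Filter.Tendsto d Filter.atTop (nhds 0))
    (hP : ∀ N M c, ‖c‖ = 1 → ‖(P N).eval c - (P M).eval c‖ ≤ d (N, M)) {h : ℂ → ℂ}
    (hh : ∀ c, ‖c‖ = 1 → Filter.Tendsto (fun N => (P N).eval c) Filter.atTop (nhds (h c)))
    (h1 : ∀ c, ‖c‖ = 1 → ‖h c‖ ≤ 1)
    (h0 : Filter.Tendsto (fun N => (P N).eval 0) Filter.atTop (nhds 1)) : h 1 = 1 := by
  have hfr : frontier (Metric.ball (0 : ℂ) 1) = Metric.sphere 0 1 :=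
    frontier_ball 0 one_ne_zero
  have hcl : closure (Metric.ball (0 : ℂ) 1) = Metric.closedBall 0 1 :=
    closure_ball 0 one_ne_zero
  -- The maximum principle for the difference of two polynomials extends the Cauchy estimate from
  -- the circle to the disc.
  have hP' : ∀ N M, ∀ c ∈ Metric.closedBall (0 : ℂ) 1,
      ‖(P N).eval c - (P M).eval c‖ ≤ d (N, M) := by
    intro N M c hc
    have hdiff : Differentiable ℂ fun c => (P N).eval c - (P M).eval c :=
      (P N).differentiable.sub (P M).differentiable
    refine Complex.norm_le_of_forall_mem_frontier_norm_le (U := Metric.ball (0 : ℂ) 1)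
      Metric.isBounded_ball hdiff.diffContOnCl (fun z hz => ?_) (by rwa [hcl])
    rw [hfr] at hz
    exact hP N M z (mem_sphere_zero_iff_norm.1 hz)
  have hU : UniformCauchySeqOn (fun N c => (P N).eval c) Filter.atTop
      (Metric.closedBall (0 : ℂ) 1) := by
    rw [Metric.uniformCauchySeqOn_iff]
    intro ε hε
    have hev := hd.eventually (gt_mem_nhds hε)
    rw [Filter.eventually_atTop_prod_self] at hev
    obtain ⟨N, hN⟩ := hev
    exact ⟨N, fun k hk l hl c hc => by
      rw [dist_eq_norm]; exact (hP' k l c hc).trans_lt (hN k l hk hl)⟩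
  have hex : ∀ c : ℂ, ∃ y, c ∈ Metric.closedBall (0 : ℂ) 1 →
      Filter.Tendsto (fun N => (P N).eval c) Filter.atTop (nhds y) := by
    intro c
    by_cases hc : c ∈ Metric.closedBall (0 : ℂ) 1
    · obtain ⟨y, hy⟩ := cauchySeq_tendsto_of_complete (hU.cauchySeq hc)
      exact ⟨y, fun _ => hy⟩
    · exact ⟨0, fun h => absurd h hc⟩
  choose g hg using hex
  have hT := hU.tendstoUniformlyOn_of_tendsto hg
  have hcont : ContinuousOn g (Metric.closedBall 0 1) :=
    hT.continuousOn (Filter.Frequently.of_forall fun N => (P N).continuous.continuousOn)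
  have hdiff : DifferentiableOn ℂ g (Metric.ball 0 1) :=
    (hT.mono Metric.ball_subset_closedBall).tendstoLocallyUniformlyOn.differentiableOn
      (Filter.Eventually.of_forall fun N => (P N).differentiable.differentiableOn)
      Metric.isOpen_ball
  have hdc : DiffContOnCl ℂ g (Metric.ball 0 1) := ⟨hdiff, by rwa [hcl]⟩
  have hgh : ∀ c, ‖c‖ = 1 → g c = h c := fun c hc =>
    tendsto_nhds_unique (hg c (by simp [hc])) (hh c hc)
  have hg0 : g 0 = 1 := tendsto_nhds_unique (hg 0 (by simp)) h0
  -- The limit is bounded by `1` on the circle, hence on the disc, and equals `1` at the centre; the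
  -- strong maximum principle makes it constant up to the boundary.
  have hmax : IsMaxOn (norm ∘ g) (Metric.ball 0 1) 0 := by
    intro c hc
    change ‖g c‖ ≤ ‖g 0‖
    rw [hg0, norm_one]
    refine Complex.norm_le_of_forall_mem_frontier_norm_le Metric.isBounded_ball hdc
      (fun z hz => ?_) (subset_closure hc)
    rw [hfr] at hz
    have hz' := mem_sphere_zero_iff_norm.1 hz
    rw [hgh z hz']
    exact h1 z hz'
  have hone := Complex.eqOn_closedBall_of_isMaxOn_norm hdc hmax
    (show (1 : ℂ) ∈ Metric.closedBall 0 1 by simp)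
  rw [← hgh 1 (by simp), hone, Function.const_apply, hg0]

/-- An automorphism cannot move the origin to a character that attains the norm of an element
which vanishes at the origin. -/
theorem character_ne_one (Ψ : normAlg u ≃ₐ[ℂ] normAlg u) {φ : normAlg u →ₐ[ℂ] ℂ}
    (hφ : charPoint u (polyAlg_le_normAlg u) φ = 0) {T : normAlg u}
    (hT : ‖(T : Fock n m →L[ℂ] Fock n m)‖ ≤ 1) (h0 : φ T = 0) : φ (Ψ.symm T) ≠ 1 := by
  intro h1
  set b := Ψ.symm T with hb
  set χ : normAlg u →ₐ[ℂ] ℂ := φ.comp Ψ.toAlgHom with hχ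
  obtain ⟨p, hp, hpb⟩ := mem_closure_iff_seq_limit.1 b.2
  let p' : ℕ → normAlg u := fun N => ⟨p N, polyAlg_le_normAlg u (hp N)⟩
  choose P hP0 hP using fun N => exists_polynomial_gauge χ φ hφ (hp N)
  choose! Γ hΓE hΓF using fun (c : ℂ) (hc : ‖c‖ = 1) => exists_gauge u hc
  have lim : ∀ ψ : normAlg u →ₐ[ℂ] ℂ,
      Filter.Tendsto (fun N => ψ (p' N)) Filter.atTop (nhds (ψ b)) := by
    intro ψ
    rw [tendsto_iff_norm_sub_tendsto_zero] at hpb ⊢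
    refine squeeze_zero (fun _ => norm_nonneg _) (fun N => ?_) hpb
    rw [← map_sub]
    exact norm_character_le ψ (p' N - b)
  have hPΓ : ∀ N c, ‖c‖ = 1 → (P N).eval c = (χ.comp (Γ c)) (p' N) := fun N c hc =>
    (hP N c (Γ c) (hΓE c hc) (hΓF c hc)).symm
  have hcau : Filter.Tendsto (fun q : ℕ × ℕ => ‖p q.1 - p q.2‖) Filter.atTop (nhds 0) := by
    have := cauchySeq_iff_tendsto_dist_atTop_0.1 hpb.cauchySeq
    simpa only [dist_eq_norm] using this
  -- On the circle `h` is a character composed with `Ψ⁻¹` and evaluated at the contraction `T`, so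
  -- it is bounded by `1`. The polynomials tend to `φ b = 1` at the origin.
  have key := tendsto_one_of_circle (P := P) (h := fun c => (χ.comp (Γ c)) b) hcau
    (fun N M c hc => by
      rw [hPΓ N c hc, hPΓ M c hc, ← map_sub]
      exact norm_character_le _ (p' N - p' M))
    (fun c hc => by
      simp only [hPΓ _ c hc]
      exact lim _)
    (fun c _ => by
      have := norm_character_le ((χ.comp (Γ c)).comp Ψ.symm.toAlgHom) T
      exact this.trans hT)
    (by
      simp only [hP0]
      rw [← h1]
      exact lim φ)
  -- `Γ 1` is only a chosen homomorphism fixing the generators; comparing it with the identity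
  -- through `P.eval 1` avoids proving that it is the identity.
  have hΓ1 : Filter.Tendsto (fun N => (χ.comp (Γ 1)) (p' N)) Filter.atTop (nhds (χ b)) := by
    have e : ∀ N, (χ.comp (Γ 1)) (p' N) = χ (p' N) := fun N => by
      rw [← hPΓ N 1 norm_one, ← hP N 1 (AlgHom.id ℂ _) (fun i => (one_smul ℂ _).symm)
        (fun j => (one_smul ℂ _).symm)]
      rfl
    simp only [e]
    exact lim χ
  have e1 : (χ.comp (Γ 1)) b = χ b := tendsto_nhds_unique (lim _) hΓ1
  have e2 : χ b = 0 := by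
    rw [hχ, hb]
    refine Eq.trans ?_ h0
    exact congrArg φ (Ψ.apply_symm_apply T)
  have : (1 : ℂ) = 0 := key.symm.trans (e1.trans e2)
  exact one_ne_zero this

theorem norm_lt_one_of_row (Ψ : normAlg u ≃ₐ[ℂ] normAlg u) {φ : normAlg u →ₐ[ℂ] ℂ}
    (hφ : charPoint u (polyAlg_le_normAlg u) φ = 0) {k : ℕ} {L : Fin k → normAlg u}
    (hL : IsRowIsometry fun i => (L i : Fock n m →L[ℂ] Fock n m)) (h0 : ∀ i, φ (L i) = 0)
    {z : EuclideanSpace ℂ (Fin k)} (hz : ∀ i, φ (Ψ.symm (L i)) = z i) : ‖z‖ < 1 := by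
  by_contra hcon
  rw [not_lt] at hcon
  have hpos : (0 : ℝ) < ‖z‖ := by linarith
  -- The scaling makes the image character equal to `1` at `T`, while the norm is at most `1 / ‖z‖ ≤
  -- 1`.
  let T : normAlg u := ((‖z‖ : ℂ) ^ 2)⁻¹ • ∑ i, conj (z i) • L i
  have hTcoe : (T : Fock n m →L[ℂ] Fock n m) =
      ((‖z‖ : ℂ) ^ 2)⁻¹ • rowComb (fun i => (L i : Fock n m →L[ℂ] Fock n m)) z := by
    simp only [T, rowComb]
    push_cast
    rfl
  refine character_ne_one Ψ hφ (T := T) ?_ ?_ ?_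
  · rw [hTcoe, norm_smul, norm_inv, norm_pow, Complex.norm_real, norm_norm]
    have h1 := norm_rowComb_le hL z
    rw [inv_mul_le_iff₀ (by positivity)]
    nlinarith
  · refine (algHom_smul_sum φ _ _ L).trans ?_
    simp only [h0, mul_zero, Finset.sum_const_zero]
  · refine (algHom_smul_sum (φ.comp Ψ.symm.toAlgHom) _ _ L).trans ?_
    have hz' : ∀ i, (φ.comp Ψ.symm.toAlgHom) (L i) = z i := hz
    simp only [hz', sum_conj_mul_self]
    refine inv_mul_cancel₀ ?_
    exact_mod_cast (pow_pos hpos 2).ne'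

theorem mem_openBalls_of_moves {Ψ : normAlg u ≃ₐ[ℂ] normAlg u} {p : Pt n m}
    (hΨ : Moves u Ψ 0 p) : p ∈ openBalls n m := by
  obtain ⟨φ, h0, rfl⟩ := hΨ
  refine ⟨mem_ball_zero_iff.2 ?_, mem_ball_zero_iff.2 ?_⟩
  · exact norm_lt_one_of_row Ψ h0 (L := genE u) isRowIsometry_Le
      (fun i => by rw [← charPoint_fst, h0]; rfl) fun i => rfl
  · exact norm_lt_one_of_row Ψ h0 (L := genF u) (isRowIsometry_Lf u)
      (fun j => by rw [← charPoint_snd, h0]; rfl) fun j => rfl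

end Gauge

/-! ### The relative interior of the core -/

section Interior

variable {n m : ℕ} (u : Matrix.unitaryGroup (Fin n × Fin m) ℂ)

/-- The real linear subspace cut out by the equations of the core. -/
def coreSpace : Submodule ℝ (Pt n m) where
  carrier := {p | ∀ i j,
    Matrix.mulVec (cMat u i j) p.2 = 0 ∧ Matrix.mulVec (cMat u i j).transpose p.1 = 0}
  add_mem' {p q} hp hq i j := by
    simp only [Prod.snd_add, Prod.fst_add, WithLp.ofLp_add, Matrix.mulVec_add, (hp i j).1,
      (hp i j).2, (hq i j).1, (hq i j).2, add_zero, and_self]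
  zero_mem' i j := ⟨Matrix.mulVec_zero _, Matrix.mulVec_zero _⟩
  smul_mem' c p hp i j := by
    simp only [Prod.smul_snd, Prod.smul_fst, WithLp.ofLp_smul, Matrix.mulVec_smul, (hp i j).1,
      (hp i j).2, smul_zero, and_self]

theorem isOpen_openBalls : IsOpen (openBalls n m) := Metric.isOpen_ball.prod Metric.isOpen_ball

theorem zero_mem_core : (0 : Pt n m) ∈ core u :=
  ⟨⟨by simp, by simp⟩, (coreSpace u).zero_mem⟩

theorem affineSpan_core_le : affineSpan ℝ (core u) ≤ (coreSpace u).toAffineSubspace :=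
  affineSpan_le.2 fun _ hp => hp.2

theorem intrinsicInterior_core :
    intrinsicInterior ℝ (core u) = core u ∩ openBalls n m := by
  ext p
  rw [mem_intrinsicInterior]
  constructor
  · rintro ⟨y, hy, rfl⟩
    have hcore : y ∈ (Subtype.val ⁻¹' core u : Set (affineSpan ℝ (core u))) := interior_subset hy
    refine ⟨hcore, ?_⟩
    have h0 : (0 : Pt n m) ∈ affineSpan ℝ (core u) := subset_affineSpan ℝ _ (zero_mem_core u)
    -- The ray from the origin through `y` stays in the core slightly beyond `y`, so `t y` is in the
    -- core for some `t > 1` and both norms of `y` are below `1`.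
    let f : ℝ → affineSpan ℝ (core u) := fun t =>
      ⟨AffineMap.lineMap 0 (y : Pt n m) t, AffineMap.lineMap_mem t h0 y.2⟩
    have hf : Continuous f := by
      refine Continuous.subtype_mk ?_ _
      exact AffineMap.lineMap_continuous
    have hf1 : f 1 = y := Subtype.ext (by simp [f])
    have hev : ∀ᶠ t in nhds (1 : ℝ), (f t : Pt n m) ∈ core u := by
      have h1 : f ⁻¹' interior ((↑) ⁻¹' core u) ∈ nhds (1 : ℝ) :=
        hf.continuousAt.preimage_mem_nhds (by rw [hf1]; exact isOpen_interior.mem_nhds hy)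
      filter_upwards [h1] with t ht
      have : f t ∈ (Subtype.val ⁻¹' core u : Set (affineSpan ℝ (core u))) := interior_subset ht
      exact this
    obtain ⟨t, ht, ht1⟩ := (hev.filter_mono nhdsWithin_le_nhds).and
      (self_mem_nhdsWithin : Set.Ioi (1 : ℝ) ∈ nhdsWithin 1 (Set.Ioi 1)) |>.exists
    have ht1 : 1 < t := ht1
    have hft : (f t : Pt n m) = t • (y : Pt n m) := by simp [f, AffineMap.lineMap_apply]
    rw [hft] at ht
    have key : ∀ {k : ℕ} {x : EuclideanSpace ℂ (Fin k)}, t • x ∈ Metric.closedBall 0 1 →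
        x ∈ Metric.ball 0 1 := by
      intro k x hx
      rw [mem_closedBall_zero_iff, norm_smul, Real.norm_eq_abs, abs_of_pos (by linarith)] at hx
      rw [mem_ball_zero_iff]
      by_contra hcon
      nlinarith
    exact ⟨key ht.1.1, key ht.1.2⟩
  · rintro ⟨hp, hb⟩
    -- The affine span satisfies the linear equations, so within it the open balls already lie
    -- inside the core.
    let V : Set (affineSpan ℝ (core u)) := Subtype.val ⁻¹' openBalls n m
    have hV : IsOpen V := isOpen_openBalls.preimage continuous_subtype_val
    have hsub : V ⊆ Subtype.val ⁻¹' core u := fun q hq =>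
      ⟨⟨Metric.ball_subset_closedBall hq.1, Metric.ball_subset_closedBall hq.2⟩,
        affineSpan_core_le u q.2⟩
    let q : affineSpan ℝ (core u) := ⟨p, subset_affineSpan ℝ _ hp⟩
    have hq : q ∈ V := hb
    exact ⟨q, interior_maximal hsub hV hq, rfl⟩

end Interior

end UnitaryRelation

end

open UnitaryRelation in
theorem theorem4p8 {n m : ℕ} (u : Matrix.unitaryGroup (Fin n × Fin m) ℂ) :
    (∀ p ∈ openBalls n m,
      List.TFAE [
        p ∈ core u,
        ∃ Ψ : wstarAlg u ≃ₐ[ℂ] wstarAlg u,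
          CompletelyIsometric Ψ ∧ IsWStarHomeo u Ψ ∧ RestrictsToNormAlg u Ψ ∧ WStarMoves u Ψ 0 p,
        ∃ Ψ : normAlg u ≃ₐ[ℂ] normAlg u, Moves u Ψ 0 p]) ∧
    core u ∩ openBalls n m = originOrbit u ∧
    intrinsicInterior ℝ (core u) = originOrbit u := by
  have h : ∀ p ∈ openBalls n m, List.TFAE [
      p ∈ core u,
      ∃ Ψ : wstarAlg u ≃ₐ[ℂ] wstarAlg u,
        CompletelyIsometric Ψ ∧ IsWStarHomeo u Ψ ∧ RestrictsToNormAlg u Ψ ∧ WStarMoves u Ψ 0 p,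
      ∃ Ψ : normAlg u ≃ₐ[ℂ] normAlg u, Moves u Ψ 0 p] := by
    intro p hp
    tfae_have 1 → 2 := fun hc => exists_wstar_aut hc hp
    tfae_have 2 → 3 := fun ⟨Ψ, _, _, hr, hm⟩ => exists_norm_aut Ψ hr hm
    tfae_have 3 → 1 := fun ⟨_, hm⟩ => mem_core_of_moves hm hp
    tfae_finish
  have ho : core u ∩ openBalls n m = originOrbit u := by
    ext p
    refine ⟨fun hp => ((h p hp.2).out 0 2).1 hp.1, fun ⟨Ψ, hm⟩ => ?_⟩
    exact ⟨mem_core_of_moves hm (mem_openBalls_of_moves hm), mem_openBalls_of_moves hm⟩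
  exact ⟨h, ho, (intrinsicInterior_core u).trans ho⟩
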